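/- For a bounded set $K\subset\mathbb R^n$ let $w(K)=\mathbb E\sup_{x\in K}|\langle g,x\rangle|$, $g\sim\mathcal N(0,I_n)$, be its Gaussian mean width, and let $d(K)=\sup_{x\in K}\|x\|_2$ (for $K=\emptyset$ all suprema are read as $0$). Let $m\ge 1$, and let $A$ be an $m\times n$ random matrix with independent $\mathcal N(0,1)$ entries. A map $f:X\to Y$ of metric spaces is a $\delta$-isometry if $|d_Y(f(x),f(x'))-d_X(x,x')|\le\delta$ for all $x,x'\in X$ and every $y\in Y$ satisfies $d_Y(y,f(x))\le\delta$ for some $x\in X$; it is a $\delta$-isometric embedding if $f:X\to f(X)$ is a $\delta$-isometry. 1. For every bounded $K\subset\mathbb R^n$, the random variable $Z=\sup_{x\in K}\bigl|\tfrac1m\|Ax\|_1-\sqrt{2/\pi}\,\|x\|_2\bigr|$ is integrable, and $$\mathbb E Z\le \frac{4w(K)}{\sqrt m}.$$ Moreover, if $d(K)>0$, then $$\mathbb P\Bigl\{Z>\frac{4w(K)}{\sqrt m}+u\Bigr\}\le 2\exp\Bigl(-\frac{mu^2}{2d(K)^2}\Bigr)\qquad\text{for all }u>0 .$$ 2. There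 is an absolute constant $C>0$ such that for all $n$, all $m\ge1$, every bounded $K\subset\mathbb R^n$ and every $\delta>0$ with $m\ge C\delta^{-2}w(K)^2$ the following hold. (a) If $r>0$ and $\operatorname{diam}(K)\le 2r$, then with probability at least $1-2\exp\bigl(-m\delta^2/(32r^2)\bigr)$ the linear map $f(x)=\frac1m\sqrt{\frac{\pi}{2}}\,Ax$ is a $\delta$-isometric embedding of $(K,\|\cdot\|_2)$ into $\ell_1^m$. In particular ($r=1$), if $\operatorname{diam}(K)\le 2$, for instance if $K$ lies in the unit Euclidean ball, this probability is at least $1-2\exp(-m\delta^2/32)$. (b) There is a linear map $T:\ell_2^n\to\ell_1^m$ whose restriction to $K$ is a $\delta$-isometric embedding into $\ell_1^m$, and the Gromov–Hausdorff distance between $(K,\|\cdot\|_2)$ and $(T(K),\|\cdot\|_1)$ is at most $\delta$. -/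

import Mathlib

open MeasureTheory ProbabilityTheory
open scoped ENNReal

noncomputable section

/-- The Gaussian mean width `w(K) = E sup_{x ∈ K} |⟨g, x⟩|` with `g ∼ N(0, I_n)`,
of a bounded set `K ⊆ ℝⁿ`. -/
def gaussianMeanWidth {n : ℕ} (K : Set (EuclideanSpace ℝ (Fin n))) : ℝ :=
  ∫ g, (⨆ x : K, |inner ℝ g (x : EuclideanSpace ℝ (Fin n))|)
    ∂(stdGaussian (EuclideanSpace ℝ (Fin n)))

/-- The radius `d(K) = sup_{x ∈ K} ‖x‖₂` of a bounded set `K ⊆ ℝⁿ`. -/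
def euclideanRadius {n : ℕ} (K : Set (EuclideanSpace ℝ (Fin n))) : ℝ :=
  ⨆ x : K, ‖(x : EuclideanSpace ℝ (Fin n))‖

/-- `A` is an `m × n` standard Gaussian matrix on the probability space `(Ω, μ)`: its entries
are independent `N(0, 1)` random variables. -/
structure IsStdGaussianMatrix {Ω : Type*} [MeasurableSpace Ω] (μ : Measure Ω) {m n : ℕ}
    (A : Ω → Matrix (Fin m) (Fin n) ℝ) : Prop where
  hasLaw_entry : ∀ i j, HasLaw (fun ω => A ω i j) (gaussianReal 0 1) μ
  indep_entries : iIndepFun (fun (p : Fin m × Fin n) ω => A ω p.1 p.2) μ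

/-- The linear map `x ↦ A x` from `ℓ₂ⁿ` to `ℓ₁ᵐ`. -/
def mulVecL1 {m n : ℕ} (A : Matrix (Fin m) (Fin n) ℝ) :
    EuclideanSpace ℝ (Fin n) →ₗ[ℝ] PiLp 1 (fun _ : Fin m => ℝ) :=
  Matrix.toLpLin 2 1 A

/-- `Z(A) = sup_{x ∈ K} | m⁻¹ ‖A x‖₁ - √(2/π) ‖x‖₂ |`. -/
def l1Deviation {m n : ℕ} (K : Set (EuclideanSpace ℝ (Fin n)))
    (A : Matrix (Fin m) (Fin n) ℝ) : ℝ :=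
  ⨆ x : K, |(m : ℝ)⁻¹ * ‖mulVecL1 A x‖
    - √(2 / Real.pi) * ‖(x : EuclideanSpace ℝ (Fin n))‖|

/-- An `ε`-isometry between metric spaces: distances are preserved up to an additive error `ε`,
and every point of the target is within `ε` of the image. -/
def IsAlmostIsometry {X Y : Type*} [MetricSpace X] [MetricSpace Y] (ε : ℝ) (f : X → Y) : Prop :=
  (∀ x x', |dist (f x) (f x') - dist x x'| ≤ ε) ∧ ∀ y, ∃ x, dist y (f x) ≤ ε

/-- An `ε`-isometric embedding: an `ε`-isometry onto its image. -/
def IsAlmostIsometricEmbedding {X Y : Type*} [MetricSpace X] [MetricSpace Y] (ε : ℝ)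
    (f : X → Y) : Prop :=
  IsAlmostIsometry ε (Set.rangeFactorization f)

/-- The Gromov–Hausdorff distance of two metric spaces: the infimum, over all isometric embeddings
of both into a common metric space, of the Hausdorff distance of the images. Mathlib's own version
is restricted to nonempty compact spaces. -/
def gromovHausdorffEDist (X Y : Type) [MetricSpace X] [MetricSpace Y] : ℝ≥0∞ :=
  sInf {d : ℝ≥0∞ | ∃ (M : Type) (_ : MetricSpace M) (Φ : X → M) (Ψ : Y → M),
    Isometry Φ ∧ Isometry Ψ ∧ d = Metric.hausdorffEDist (Set.range Φ) (Set.range Ψ)}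

end

/-!
The random variable `Z(A) = sup_{x ∈ K} |m⁻¹ ‖A x‖₁ - √(2/π) ‖x‖₂|` is a Lipschitz function of the
matrix `A`, with constant `d(K) / √m` for the Frobenius norm, so that everything reduces to a bound
for its mean and to Gaussian concentration. The matrix `A` is treated as a standard Gaussian vector
of `EuclideanSpace ℝ (Fin m × Fin n)`.

*Mean.* Since `√(2/π) ‖x‖₂ = E |⟨g, x⟩|`, the centering may be replaced by an independent copy of
`A`. Exchanging rows of the two copies introduces arbitrary signs, at the cost of a factor `2`
(`integral_l1Deviation_le_signedSup`). Averaging over the signs, the contraction principle for the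
absolute value (`sum_ciSup_abs_sign_abs_le`) removes the absolute values around `⟨aᵢ, x⟩`, at the
cost of another factor `2`. For fixed signs `εᵢ`, the vector `m^{-1/2} ∑ εᵢ aᵢ` is standard
Gaussian, which produces `√m w(K)`.

*Concentration.* The sharp estimate `E exp F ≤ exp (E F + L² / 2)` for an `L`-Lipschitz function `F`
of a Gaussian vector (`integral_exp_le_of_abs_sub_le`) is obtained by following the heat semigroup
in small steps. At a small scale `σ`, a function with bounded Lipschitz gradient is affine up to
`O(σ²)`, and the estimate holds with `σ² L² / 2 + O(σ³)` in the exponent. The Gaussian average of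
such a function is a function of the same kind, so that two steps of scale `σ` compose to one step
of scale `√2 σ` with twice the exponent. Starting from `σ = 2^{-k/2}` and letting `k → ∞` gives the
estimate for smooth functions, and mollification gives the general case.

*Embedding.* Both facts are applied to `K - K`, which has mean width at most `2 w(K)` and radius at
most `diam K`. A small deviation on `K - K` says that `A`, suitably normalized, almost preserves the
distances between points of `K`; for the Gromov–Hausdorff distance, `K` is glued to its image along
the map.
-/

/-! ### Exponential moments of smooth functions of a Gaussian vector -/

section Concentration

lemma abs_add_smul_sub_le {E : Type*} [NormedAddCommGroup E] [NormedSpace ℝ E]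
    {F : E → ℝ} {L : ℝ} (h : ∀ x y, |F x - F y| ≤ L * ‖x - y‖) (x : E) {σ : ℝ}
    (hσ : 0 ≤ σ) (z w : E) :
    |F (x + σ • z) - F (x + σ • w)| ≤ L * σ * ‖z - w‖ := by
  have := h (x + σ • z) (x + σ • w)
  rwa [add_sub_add_left_eq_sub, ← smul_sub, norm_smul, Real.norm_of_nonneg hσ, ← mul_assoc] at this

lemma continuous_of_abs_sub_le {E : Type*} [SeminormedAddCommGroup E] {F : E → ℝ}
    {L : ℝ} (h : ∀ x y, |F x - F y| ≤ L * ‖x - y‖) :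
    Continuous F := by
  refine (LipschitzWith.of_dist_le_mul (K := L.toNNReal) fun x y => ?_).continuous
  rw [Real.dist_eq, dist_eq_norm]
  exact (h x y).trans (mul_le_mul_of_nonneg_right (Real.le_coe_toNNReal L) (norm_nonneg _))

variable {E : Type*} [NormedAddCommGroup E] [InnerProductSpace ℝ E]

/-- `F` is differentiable with gradient `G`, which is bounded by `L` and `M`-Lipschitz. -/
structure HasLipschitzGradient (L M : ℝ) (F : E → ℝ) (G : E → E →L[ℝ] ℝ) : Prop where
  hasFDerivAt : ∀ x, HasFDerivAt F (G x) x
  norm_le : ∀ x, ‖G x‖ ≤ L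
  norm_sub_le : ∀ x y, ‖G x - G y‖ ≤ M * ‖x - y‖

namespace HasLipschitzGradient

variable {L M : ℝ} {F : E → ℝ} {G : E → E →L[ℝ] ℝ}

lemma abs_sub_le (h : HasLipschitzGradient L M F G) (x y : E) : |F x - F y| ≤ L * ‖x - y‖ :=
  convex_univ.norm_image_sub_le_of_norm_hasFDerivWithin_le
    (fun x _ => (h.hasFDerivAt x).hasFDerivWithinAt) (fun x _ => h.norm_le x)
    (Set.mem_univ y) (Set.mem_univ x)

lemma abs_sub_sub_le (h : HasLipschitzGradient L M F G) (hM : 0 ≤ M) (x y : E) :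
    |F (x + y) - F x - G x y| ≤ M * ‖y‖ ^ 2 := by
  have := (convex_closedBall x ‖y‖).norm_image_sub_le_of_norm_hasFDerivWithin_le'
    (f := F) (f' := G) (φ := G x) (C := M * ‖y‖) (x := x) (y := x + y)
    (fun z _ => (h.hasFDerivAt z).hasFDerivWithinAt)
    (fun z hz => (h.norm_sub_le z x).trans
      (mul_le_mul_of_nonneg_left (by simpa [dist_eq_norm] using hz) hM))
    (by simp) (by simp [dist_eq_norm])
  simpa [sq, mul_assoc] using this

lemma continuous_gradient (h : HasLipschitzGradient L M F G) : Continuous G := by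
  refine (LipschitzWith.of_dist_le_mul (K := M.toNNReal) fun x y => ?_).continuous
  rw [dist_eq_norm, dist_eq_norm]
  exact (h.norm_sub_le x y).trans
    (mul_le_mul_of_nonneg_right (Real.le_coe_toNNReal M) (norm_nonneg _))

end HasLipschitzGradient

variable [FiniteDimensional ℝ E] [MeasurableSpace E] [BorelSpace E]

lemma integrable_exp_mul_norm_stdGaussian (c : ℝ) :
    Integrable (fun z : E => Real.exp (c * ‖z‖)) (stdGaussian E) := by
  obtain ⟨C, hC, hint⟩ := IsGaussian.exists_integrable_exp_sq (stdGaussian E)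
  refine (hint.const_mul (Real.exp (c ^ 2 / (4 * C)))).mono'
    (by fun_prop) (Filter.Eventually.of_forall fun z => ?_)
  rw [Real.norm_of_nonneg (Real.exp_pos _).le, ← Real.exp_add]
  refine Real.exp_le_exp.2 ?_
  have h : c ^ 2 / (4 * C) + C * ‖z‖ ^ 2 - c * ‖z‖ = (c - 2 * C * ‖z‖) ^ 2 / (4 * C) := by
    field_simp
    ring
  have : 0 ≤ (c - 2 * C * ‖z‖) ^ 2 / (4 * C) := by positivity
  linarith

lemma integrable_stdGaussian_of_le_exp {f : E → ℝ} (hf : Continuous f) (a c : ℝ)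
    (h : ∀ z, |f z| ≤ a * Real.exp (c * ‖z‖)) : Integrable f (stdGaussian E) :=
  ((integrable_exp_mul_norm_stdGaussian c).const_mul a).mono' hf.aestronglyMeasurable
    (Filter.Eventually.of_forall h)

lemma integrable_norm_pow_stdGaussian (k : ℕ) :
    Integrable (fun z : E => ‖z‖ ^ k) (stdGaussian E) := by
  refine integrable_stdGaussian_of_le_exp (by fun_prop) (k.factorial : ℝ) 1 fun z => ?_
  have := Real.pow_div_factorial_le_exp ‖z‖ (norm_nonneg z) k
  rw [div_le_iff₀ (by positivity)] at this
  rw [abs_of_nonneg (by positivity), one_mul]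
  linarith

lemma integrable_stdGaussian_of_abs_sub_le {F : E → ℝ} (hF : Continuous F) (L : ℝ)
    (h : ∀ z, |F z - F 0| ≤ L * ‖z‖) : Integrable F (stdGaussian E) := by
  have h1 : Integrable (fun z => F z - F 0) (stdGaussian E) :=
    (((integrable_norm_pow_stdGaussian (E := E) 1).const_mul L)).mono'
      (by fun_prop) (Filter.Eventually.of_forall fun z => by simpa using h z)
  refine (h1.add (integrable_const (F 0))).congr (Filter.Eventually.of_forall fun z => ?_)
  simp

lemma integrable_exp_stdGaussian_of_abs_sub_le {F : E → ℝ} (hF : Continuous F) (L : ℝ)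
    (h : ∀ z, |F z - F 0| ≤ L * ‖z‖) :
    Integrable (fun z => Real.exp (F z)) (stdGaussian E) := by
  refine integrable_stdGaussian_of_le_exp (by fun_prop) (Real.exp (F 0)) L fun z => ?_
  rw [abs_of_pos (Real.exp_pos _), ← Real.exp_add]
  have := (abs_le.1 (h z)).2
  exact Real.exp_le_exp.2 (by linarith)

lemma integrable_shift {F : E → ℝ} {L : ℝ} (h : ∀ x y, |F x - F y| ≤ L * ‖x - y‖) (x : E)
    {σ : ℝ} (hσ : 0 ≤ σ) : Integrable (fun z => F (x + σ • z)) (stdGaussian E) := by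
  have hc := continuous_of_abs_sub_le h
  refine integrable_stdGaussian_of_abs_sub_le (by fun_prop) (L * σ) fun z => ?_
  simpa using abs_add_smul_sub_le h x hσ z 0

lemma integrable_exp_shift {F : E → ℝ} {L : ℝ} (h : ∀ x y, |F x - F y| ≤ L * ‖x - y‖) (x : E)
    {σ : ℝ} (hσ : 0 ≤ σ) :
    Integrable (fun z => Real.exp (F (x + σ • z))) (stdGaussian E) := by
  have hc := continuous_of_abs_sub_le h
  refine integrable_exp_stdGaussian_of_abs_sub_le (by fun_prop) (L * σ) fun z => ?_
  simpa using abs_add_smul_sub_le h x hσ z 0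

namespace HasLipschitzGradient

variable {L M : ℝ} {F : E → ℝ} {G : E → E →L[ℝ] ℝ}

/-- The class of functions with bounded Lipschitz gradient is stable under the heat semigroup. -/
lemma integral_shift (h : HasLipschitzGradient L M F G) {σ : ℝ} (hσ : 0 ≤ σ) :
    HasLipschitzGradient L M (fun x => ∫ z, F (x + σ • z) ∂(stdGaussian E))
      (fun x => ∫ z, G (x + σ • z) ∂(stdGaussian E)) := by
  have hcF := continuous_of_abs_sub_le h.abs_sub_le
  have hcG := h.continuous_gradient
  have hint : ∀ x, Integrable (fun z => G (x + σ • z)) (stdGaussian E) := fun x =>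
    (integrable_const L).mono' (by fun_prop : Continuous _).aestronglyMeasurable
      (Filter.Eventually.of_forall fun z => h.norm_le _)
  refine ⟨fun x => ?_, fun x => ?_, fun x y => ?_⟩
  · refine hasFDerivAt_integral_of_dominated_of_fderiv_le (bound := fun _ => L)
      (F' := fun y z => G (y + σ • z)) Filter.univ_mem
      (Filter.Eventually.of_forall fun y =>
        (by fun_prop : Continuous fun z => F (y + σ • z)).aestronglyMeasurable)
      (integrable_shift h.abs_sub_le x hσ) (hint x).1
      (Filter.Eventually.of_forall fun z y _ => h.norm_le _) (integrable_const L)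
      (Filter.Eventually.of_forall fun z y _ => ?_)
    exact (hasFDerivAt_comp_add_right (σ • z)).2 (h.hasFDerivAt (y + σ • z))
  · simpa using norm_integral_le_of_norm_le_const (μ := stdGaussian E)
      (Filter.Eventually.of_forall fun z => h.norm_le (x + σ • z))
  · rw [← integral_sub (hint x) (hint y)]
    simpa using norm_integral_le_of_norm_le_const (μ := stdGaussian E)
      (Filter.Eventually.of_forall fun z => by
        simpa using h.norm_sub_le (x + σ • z) (y + σ • z))

end HasLipschitzGradient

lemma Real.exp_le_taylor_two (t : ℝ) :
    Real.exp t ≤ 1 + t + t ^ 2 / 2 + |t| ^ 3 * Real.exp |t| := by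
  have h := Complex.norm_exp_sub_sum_le_norm_mul_exp (t : ℂ) 3
  have h2 : Complex.exp (t : ℂ) - ∑ m ∈ Finset.range 3, (t : ℂ) ^ m / (m.factorial : ℂ)
      = ((Real.exp t - (1 + t + t ^ 2 / 2) : ℝ) : ℂ) := by
    simp [Finset.sum_range_succ, Nat.factorial]
  rw [h2, Complex.norm_real, Complex.norm_real, Real.norm_eq_abs, Real.norm_eq_abs] at h
  have := (abs_le.1 h).2
  linarith

lemma integral_strongDual_sq_stdGaussian (L : StrongDual ℝ E) :
    ∫ z, L z ^ 2 ∂(stdGaussian E) = ‖L‖ ^ 2 := by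
  rw [← variance_dual_stdGaussian L, variance_eq_integral (by fun_prop),
    integral_strongDual_stdGaussian]
  simp

/-- The exponential moment estimate at a small scale `σ`, where a smooth function is affine up to
an error of order `σ ^ 2`; the error `C * σ ^ 3` vanishes when `σ⁻²` such steps are composed. -/
lemma exists_integral_exp_shift_le (L M : ℝ) (hL : 0 ≤ L) (hM : 0 ≤ M) :
    ∃ C : ℝ, ∀ (F : E → ℝ) (G : E → E →L[ℝ] ℝ), HasLipschitzGradient L M F G →
      ∀ (x : E) (σ : ℝ), 0 ≤ σ → σ ≤ 1 →
        ∫ z, Real.exp (F (x + σ • z)) ∂(stdGaussian E) ≤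
          Real.exp ((∫ z, F (x + σ • z) ∂(stdGaussian E)) + (σ ^ 2 * L ^ 2 / 2 + C * σ ^ 3)) := by
  set γ := stdGaussian E
  set c := ∫ z : E, ‖z‖ ∂γ with hc
  have hn1 : Integrable (fun z : E => ‖z‖) γ := by
    simpa using integrable_norm_pow_stdGaussian (E := E) 1
  have hc0 : 0 ≤ c := integral_nonneg fun z => norm_nonneg z
  set R : E → ℝ := fun z => (‖z‖ + c) ^ 3 * Real.exp (L * (‖z‖ + c)) with hR
  have hRint : Integrable R γ := by
    refine integrable_stdGaussian_of_le_exp (by fun_prop) (6 * Real.exp (c + L * c)) (1 + L)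
      fun z => ?_
    have h1 := Real.pow_div_factorial_le_exp (‖z‖ + c) (by positivity) 3
    rw [div_le_iff₀ (by positivity)] at h1
    rw [hR, abs_of_nonneg (by positivity)]
    calc (‖z‖ + c) ^ 3 * Real.exp (L * (‖z‖ + c))
        ≤ (Real.exp (‖z‖ + c) * (Nat.factorial 3 : ℝ)) * Real.exp (L * (‖z‖ + c)) := by gcongr
      _ = 6 * (Real.exp (‖z‖ + c) * Real.exp (L * (‖z‖ + c))) := by
        simp [Nat.factorial]; ring
      _ = 6 * (Real.exp (c + L * c) * Real.exp ((1 + L) * ‖z‖)) := by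
        rw [← Real.exp_add, ← Real.exp_add]; ring_nf
      _ = _ := by ring
  set K := ∫ z, R z ∂γ
  set m3 := ∫ z : E, ‖z‖ ^ 3 ∂γ
  set m4 := ∫ z : E, ‖z‖ ^ 4 ∂γ
  have hm4 : 0 ≤ m4 := integral_nonneg fun z => by positivity
  refine ⟨L * M * m3 + M ^ 2 * m4 / 2 + L ^ 3 * K, fun F G h x σ hσ hσ1 => ?_⟩
  have hlip := fun z w => abs_add_smul_sub_le h.abs_sub_le x hσ z w
  have hFc := continuous_of_abs_sub_le h.abs_sub_le
  have hFi : Integrable (fun z => F (x + σ • z)) γ := integrable_shift h.abs_sub_le x hσ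
  set b := ∫ z, F (x + σ • z) ∂γ with hb
  set t : E → ℝ := fun z => F (x + σ • z) - b with ht
  have htc : Continuous t := by fun_prop
  have hti : Integrable t γ := hFi.sub (integrable_const b)
  have ht0 : ∫ z, t z ∂γ = 0 := by
    rw [ht, integral_sub hFi (integrable_const b)]; simp [hb]
  have htb : ∀ z, |t z| ≤ L * σ * (‖z‖ + c) := by
    intro z
    have h1 : t z = ∫ w, (F (x + σ • z) - F (x + σ • w)) ∂γ := by
      rw [integral_sub (integrable_const _) hFi]; simp [ht, hb]
    have h2 : Integrable (fun w : E => L * σ * (‖z‖ + ‖w‖)) γ :=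
      ((integrable_const _).add hn1).const_mul _
    rw [h1]
    refine ((norm_integral_le_of_norm_le (f := fun w => F (x + σ • z) - F (x + σ • w)) h2
      (Filter.Eventually.of_forall fun w => ?_))).trans_eq ?_
    · exact (hlip z w).trans (mul_le_mul_of_nonneg_left (norm_sub_le z w) (by positivity))
    · rw [integral_const_mul, integral_add (integrable_const _) hn1]; simp [hc]
  set q : E → ℝ := fun z => F (x + σ • z) - F x with hq
  have hqb : ∀ z, |q z| ≤ L * σ * ‖z‖ := fun z => by simpa using hlip z 0
  have hn2 := integrable_norm_pow_stdGaussian (E := E) 2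
  have hn3 := integrable_norm_pow_stdGaussian (E := E) 3
  have hn4 := integrable_norm_pow_stdGaussian (E := E) 4
  have hqi : Integrable (fun z => q z ^ 2) γ := by
    refine (hn2.const_mul ((L * σ) ^ 2)).mono' (by fun_prop)
      (Filter.Eventually.of_forall fun z => ?_)
    rw [Real.norm_eq_abs, abs_pow, ← mul_pow]
    exact pow_le_pow_left₀ (abs_nonneg _) (hqb z) 2
  have hqt : ∀ z, q z ^ 2 = t z ^ 2 + 2 * (b - F x) * t z + (b - F x) ^ 2 := fun z => by
    simp only [hq, ht]; ring
  have hti2 : Integrable (fun z => t z ^ 2) γ := by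
    have : (fun z => t z ^ 2) = fun z => q z ^ 2 - 2 * (b - F x) * t z - (b - F x) ^ 2 := by
      funext z; rw [hqt]; ring
    rw [this]
    exact (hqi.sub (hti.const_mul _)).sub (integrable_const _)
  -- the variance is at most the second moment about `F x`
  have hvar : ∫ z, t z ^ 2 ∂γ ≤ ∫ z, q z ^ 2 ∂γ := by
    have : ∫ z, q z ^ 2 ∂γ = ∫ z, t z ^ 2 ∂γ + (b - F x) ^ 2 := by
      have hi : Integrable (fun z => t z ^ 2 + 2 * (b - F x) * t z) γ :=
        hti2.add (hti.const_mul _)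
      simp_rw [hqt]
      rw [integral_add hi (integrable_const _),
        integral_add hti2 (hti.const_mul _), integral_const_mul, ht0]
      simp
    rw [this]
    nlinarith [sq_nonneg (b - F x)]
  have hqpt : ∀ z, q z ^ 2 ≤
      σ ^ 2 * G x z ^ 2 + (2 * σ ^ 3 * (L * M)) * ‖z‖ ^ 3 + (M ^ 2 * σ ^ 4) * ‖z‖ ^ 4 := by
    intro z
    have h1 : |q z - σ * G x z| ≤ M * σ ^ 2 * ‖z‖ ^ 2 := by
      have := h.abs_sub_sub_le hM x (σ • z)
      rw [norm_smul, Real.norm_of_nonneg hσ, map_smul, smul_eq_mul] at this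
      simpa [hq, mul_pow, mul_assoc] using this
    have h2 : |G x z| ≤ L * ‖z‖ :=
      ((G x).le_opNorm z).trans (mul_le_mul_of_nonneg_right (h.norm_le x) (norm_nonneg z))
    set D := q z - σ * G x z with hD
    have h3 : q z = σ * G x z + D := by rw [hD]; ring
    have h4 : D ^ 2 ≤ (M * σ ^ 2 * ‖z‖ ^ 2) ^ 2 := sq_le_sq' (abs_le.1 h1).1 (abs_le.1 h1).2
    have h5 : G x z * D ≤ (L * ‖z‖) * (M * σ ^ 2 * ‖z‖ ^ 2) :=
      (le_abs_self _).trans (by rw [abs_mul]; gcongr)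
    have h6 := mul_le_mul_of_nonneg_left h5 hσ
    rw [h3]
    nlinarith
  have hGi : Integrable (fun z => G x z ^ 2) γ := by
    refine (hn2.const_mul (‖G x‖ ^ 2)).mono' (by fun_prop)
      (Filter.Eventually.of_forall fun z => ?_)
    rw [Real.norm_eq_abs, abs_pow, ← mul_pow]
    exact pow_le_pow_left₀ (abs_nonneg _) ((G x).le_opNorm z) 2
  have hq2 : ∫ z, q z ^ 2 ∂γ ≤
      σ ^ 2 * L ^ 2 + (2 * σ ^ 3 * (L * M)) * m3 + (M ^ 2 * σ ^ 4) * m4 := by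
    have hi : Integrable (fun z => σ ^ 2 * G x z ^ 2 + (2 * σ ^ 3 * (L * M)) * ‖z‖ ^ 3) γ :=
      (hGi.const_mul _).add (hn3.const_mul _)
    refine (integral_mono hqi (hi.add (hn4.const_mul _)) hqpt).trans ?_
    simp only [Pi.add_apply]
    rw [integral_add hi (hn4.const_mul _),
      integral_add (hGi.const_mul _) (hn3.const_mul _), integral_const_mul, integral_const_mul,
      integral_const_mul, integral_strongDual_sq_stdGaussian]
    gcongr
    exact h.norm_le x
  have hexp : ∀ z, Real.exp (t z) ≤ 1 + t z + t z ^ 2 / 2 + (σ ^ 3 * L ^ 3) * R z := by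
    intro z
    refine (Real.exp_le_taylor_two (t z)).trans ?_
    have h1 : |t z| ^ 3 ≤ (L * σ * (‖z‖ + c)) ^ 3 := pow_le_pow_left₀ (abs_nonneg _) (htb z) 3
    have h2 : |t z| ≤ L * (‖z‖ + c) := by
      refine (htb z).trans ?_
      have : 0 ≤ L * (‖z‖ + c) := by positivity
      nlinarith
    have h3 : |t z| ^ 3 * Real.exp |t z| ≤
        (L * σ * (‖z‖ + c)) ^ 3 * Real.exp (L * (‖z‖ + c)) := by gcongr
    have h4 : (L * σ * (‖z‖ + c)) ^ 3 * Real.exp (L * (‖z‖ + c)) = (σ ^ 3 * L ^ 3) * R z := by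
      simp only [hR]; ring
    linarith
  have hei : Integrable (fun z => Real.exp (t z)) γ := by
    have := (integrable_exp_shift h.abs_sub_le x hσ).mul_const (Real.exp (-b))
    simpa only [← Real.exp_add, ← sub_eq_add_neg] using this
  have hi1 : Integrable (fun z => 1 + t z) γ := (integrable_const 1).add hti
  have hi2 : Integrable (fun z => 1 + t z + t z ^ 2 / 2) γ := hi1.add (hti2.div_const 2)
  have hmain : ∫ z, Real.exp (t z) ∂γ ≤
      1 + (σ ^ 2 * L ^ 2 / 2 + (L * M * m3 + M ^ 2 * m4 / 2 + L ^ 3 * K) * σ ^ 3) := by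
    refine (integral_mono hei (hi2.add (hRint.const_mul _)) hexp).trans ?_
    simp only [Pi.add_apply]
    rw [integral_add hi2 (hRint.const_mul _), integral_add hi1 (hti2.div_const 2),
      integral_add (integrable_const _) hti, ht0, integral_div, integral_const_mul]
    simp only [integral_const, probReal_univ, smul_eq_mul, mul_one]
    have h34 : M ^ 2 * σ ^ 4 * m4 ≤ M ^ 2 * σ ^ 3 * m4 := by
      have : σ ^ 4 ≤ σ ^ 3 := pow_le_pow_of_le_one hσ hσ1 (by norm_num)
      gcongr
    have h6 := hvar.trans hq2
    change 1 + 0 + (∫ z, t z ^ 2 ∂γ) / 2 + σ ^ 3 * L ^ 3 * K ≤ _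
    nlinarith
  have hfac : ∫ z, Real.exp (F (x + σ • z)) ∂γ = Real.exp b * ∫ z, Real.exp (t z) ∂γ := by
    rw [← integral_const_mul]
    congr 1
    funext z
    rw [← Real.exp_add]
    simp [ht]
  rw [hfac, Real.exp_add]
  refine mul_le_mul_of_nonneg_left (hmain.trans ?_) (Real.exp_pos b).le
  have := Real.add_one_le_exp
    (σ ^ 2 * L ^ 2 / 2 + (L * M * m3 + M ^ 2 * m4 / 2 + L ^ 3 * K) * σ ^ 3)
  linarith

/-- The sum of two independent Gaussian vectors of scale `σ` has scale `√2 * σ`. -/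
lemma integral_integral_shift_stdGaussian {f : E → ℝ} (hf : Continuous f) (x : E) (σ : ℝ)
    (hi : Integrable (fun z => f (x + (√2 * σ) • z)) (stdGaussian E)) :
    ∫ z, ∫ w, f (x + σ • z + σ • w) ∂(stdGaussian E) ∂(stdGaussian E) =
      ∫ z, f (x + (√2 * σ) • z) ∂(stdGaussian E) := by
  set γ := stdGaussian E
  set ρ : E × E →L[ℝ] E × E := ContinuousLinearMap.rotation (Real.pi / 4) with hρ
  have hrot : MeasurePreserving ρ (γ.prod γ) (γ.prod γ) :=
    ⟨ρ.continuous.measurable, IsGaussian.map_rotation_eq_self (integral_id_stdGaussian) _⟩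
  have hfst : MeasurePreserving (fun p : E × E => (ρ p).1) (γ.prod γ) γ :=
    measurePreserving_fst.comp hrot
  have key : ∀ p : E × E, f (x + σ • p.1 + σ • p.2) = f (x + (√2 * σ) • (ρ p).1) := by
    intro p
    have h2 : √2 * σ * (√2 / 2) = σ := by
      have : √2 * √2 = (2 : ℝ) := Real.mul_self_sqrt (by norm_num)
      linear_combination σ / 2 * this
    simp only [hρ, ContinuousLinearMap.rotation_apply, Real.cos_pi_div_four,
      Real.sin_pi_div_four, smul_add, smul_smul, h2, add_assoc]
  have hint : Integrable (fun p : E × E => f (x + σ • p.1 + σ • p.2)) (γ.prod γ) := by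
    simp_rw [key]
    exact hfst.integrable_comp_of_integrable hi
  rw [← integral_prod (fun p : E × E => f (x + σ • p.1 + σ • p.2)) hint]
  simp_rw [key]
  have h1 := integral_map (f := fun z => f (x + (√2 * σ) • z)) hfst.aemeasurable
    (by fun_prop : Continuous fun z => f (x + (√2 * σ) • z)).aestronglyMeasurable
  rw [hfst.map_eq] at h1
  exact h1.symm

/-- An exponential moment bound at scale `σ` for all functions of the class, applied to `F` and to
its Gaussian average, gives a bound at scale `√2 * σ`. -/
lemma integral_exp_shift_le_of_half {L M : ℝ} {σ c : ℝ} (hσ : 0 ≤ σ)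
    (hS : ∀ (F : E → ℝ) (G : E → E →L[ℝ] ℝ), HasLipschitzGradient L M F G → ∀ x : E,
        ∫ z, Real.exp (F (x + σ • z)) ∂(stdGaussian E) ≤
          Real.exp ((∫ z, F (x + σ • z) ∂(stdGaussian E)) + c))
    (F : E → ℝ) (G : E → E →L[ℝ] ℝ) (h : HasLipschitzGradient L M F G) (x : E) :
    ∫ z, Real.exp (F (x + (√2 * σ) • z)) ∂(stdGaussian E) ≤
      Real.exp ((∫ z, F (x + (√2 * σ) • z) ∂(stdGaussian E)) + 2 * c) := by
  have hFc := continuous_of_abs_sub_le h.abs_sub_le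
  have hσ2 : 0 ≤ √2 * σ := by positivity
  have hA := h.integral_shift hσ
  have h1 := integral_integral_shift_stdGaussian (f := fun y => Real.exp (F y)) (by fun_prop) x σ
    (integrable_exp_shift h.abs_sub_le x hσ2)
  have h2 := integral_integral_shift_stdGaussian hFc x σ (integrable_shift h.abs_sub_le x hσ2)
  rw [← h1, ← h2]
  have h3 := (integrable_exp_shift hA.abs_sub_le x hσ).mul_const (Real.exp c)
  calc ∫ z, ∫ w, Real.exp (F (x + σ • z + σ • w)) ∂(stdGaussian E) ∂(stdGaussian E)
      ≤ ∫ z, Real.exp (∫ w, F (x + σ • z + σ • w) ∂(stdGaussian E)) * Real.exp c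
          ∂(stdGaussian E) := by
        refine integral_mono_of_nonneg (Filter.Eventually.of_forall fun z =>
          integral_nonneg fun w => (Real.exp_pos _).le) h3 (Filter.Eventually.of_forall fun z => ?_)
        change _ ≤ _ * _
        rw [← Real.exp_add]
        exact hS F G h (x + σ • z)
    _ = (∫ z, Real.exp (∫ w, F (x + σ • z + σ • w) ∂(stdGaussian E)) ∂(stdGaussian E))
          * Real.exp c := integral_mul_const _ _
    _ ≤ Real.exp ((∫ z, ∫ w, F (x + σ • z + σ • w) ∂(stdGaussian E) ∂(stdGaussian E)) + c)
          * Real.exp c := mul_le_mul_of_nonneg_right (hS _ _ hA x) (Real.exp_pos c).le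
    _ = _ := by rw [← Real.exp_add]; ring_nf

lemma HasLipschitzGradient.integral_exp_le {L M : ℝ} {F : E → ℝ} {G : E → E →L[ℝ] ℝ}
    (h : HasLipschitzGradient L M F G) (hL : 0 ≤ L) (hM : 0 ≤ M) :
    ∫ z, Real.exp (F z) ∂(stdGaussian E) ≤
      Real.exp ((∫ z, F z ∂(stdGaussian E)) + L ^ 2 / 2) := by
  obtain ⟨C, hC⟩ := exists_integral_exp_shift_le (E := E) L M hL hM
  have h2 : (√2)⁻¹ ≤ 1 := inv_le_one_of_one_le₀ (by
    rw [Real.one_le_sqrt]; norm_num)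
  have h20 : √2 ≠ 0 := by positivity
  have step : ∀ (σ : ℝ), 0 ≤ σ → σ ≤ 1 → ∀ j : ℕ, ∀ (F : E → ℝ) (G : E → E →L[ℝ] ℝ),
      HasLipschitzGradient L M F G → ∀ x : E,
        ∫ z, Real.exp (F (x + (√2 ^ j * σ) • z)) ∂(stdGaussian E) ≤
          Real.exp ((∫ z, F (x + (√2 ^ j * σ) • z) ∂(stdGaussian E)) +
            2 ^ j * (σ ^ 2 * L ^ 2 / 2 + C * σ ^ 3)) := by
    intro σ hσ hσ1 j
    induction j with
    | zero => intro F G h x; simpa using hC F G h x σ hσ hσ1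
    | succ j ih =>
      intro F G h x
      have := integral_exp_shift_le_of_half (by positivity) ih F G h x
      rw [pow_succ' (√2), pow_succ' (2 : ℝ), mul_assoc, mul_assoc]
      exact this
  have hk : ∀ k : ℕ, ∫ z, Real.exp (F z) ∂(stdGaussian E) ≤
      Real.exp ((∫ z, F z ∂(stdGaussian E)) + (L ^ 2 / 2 + C * (√2)⁻¹ ^ k)) := by
    intro k
    have := step ((√2)⁻¹ ^ k) (by positivity) (pow_le_one₀ (by positivity) h2) k F G h 0
    have h3 : √2 ^ k * (√2)⁻¹ ^ k = 1 := by rw [← mul_pow, mul_inv_cancel₀ h20, one_pow]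
    have h4 : (2 : ℝ) ^ k * ((√2)⁻¹ ^ k) ^ 2 = 1 := by
      rw [← pow_mul, mul_comm k 2, pow_mul, ← mul_pow, inv_pow, Real.sq_sqrt (by norm_num)]
      norm_num
    have h5 : (2 : ℝ) ^ k * (((√2)⁻¹ ^ k) ^ 2 * L ^ 2 / 2 + C * ((√2)⁻¹ ^ k) ^ 3) =
        L ^ 2 / 2 + C * (√2)⁻¹ ^ k := by
      linear_combination (L ^ 2 / 2 + C * (√2)⁻¹ ^ k) * h4
    rw [h5] at this
    simpa [h3] using this
  have hlim : Filter.Tendsto (fun k : ℕ =>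
      Real.exp ((∫ z, F z ∂(stdGaussian E)) + (L ^ 2 / 2 + C * (√2)⁻¹ ^ k))) Filter.atTop
      (nhds (Real.exp ((∫ z, F z ∂(stdGaussian E)) + (L ^ 2 / 2 + C * 0)))) := by
    refine (Real.continuous_exp.tendsto _).comp
      (((tendsto_pow_atTop_nhds_zero_of_lt_one (by positivity) ?_).const_mul C).const_add _
        |>.const_add _)
    exact inv_lt_one_of_one_lt₀ (by rw [Real.lt_sqrt] <;> norm_num)
  simpa using ge_of_tendsto' hlim hk

end Concentration

/-! ### Mollification and the concentration inequality -/

section Smoothing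

variable {E : Type*} [NormedAddCommGroup E] [InnerProductSpace ℝ E] [FiniteDimensional ℝ E]

/-- Lipschitz functions are uniform limits of functions with Lipschitz gradient and the same
Lipschitz constant, by mollification. -/
lemma exists_hasLipschitzGradient_approx {F : E → ℝ} {L : ℝ} (hL : 0 ≤ L)
    (h : ∀ x y, |F x - F y| ≤ L * ‖x - y‖) {ε : ℝ} (hε : 0 < ε) :
    ∃ (M : ℝ) (H : E → ℝ) (G : E → E →L[ℝ] ℝ), 0 ≤ M ∧ HasLipschitzGradient L M H G ∧
      ∀ x, |H x - F x| ≤ L * ε := by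
  borelize E
  let μ : Measure E := Measure.addHaar
  let φ : ContDiffBump (0 : E) := ⟨ε / 2, ε, by positivity, by linarith⟩
  have hFc := continuous_of_abs_sub_le h
  have hφc : HasCompactSupport (φ.normed μ) := φ.hasCompactSupport_normed
  have hφd : ContDiff ℝ 1 (φ.normed μ) := φ.contDiff_normed
  have hFl : LocallyIntegrable F μ := hFc.locallyIntegrable
  set B := ContinuousLinearMap.lsmul ℝ ℝ (E := ℝ) with hB
  set H := convolution (φ.normed μ) F B μ with hH
  set B' := ContinuousLinearMap.precompL E B with hB'
  set G := convolution (fderiv ℝ (φ.normed μ)) F B' μ with hG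
  have hB'le : ∀ (T : E →L[ℝ] ℝ) (r : ℝ), ‖B' T r‖ ≤ ‖T‖ * |r| := fun T r => by
    refine ContinuousLinearMap.opNorm_le_bound _ (by positivity) fun v => ?_
    have := mul_le_mul_of_nonneg_right (T.le_opNorm v) (abs_nonneg r)
    simp only [hB', hB, ContinuousLinearMap.precompL_apply, ContinuousLinearMap.lsmul_apply,
      smul_eq_mul, norm_mul, Real.norm_eq_abs r]
    linarith
  have hder : ∀ x, HasFDerivAt H (G x) x := fun x =>
    hφc.hasFDerivAt_convolution_left B hφd hFl x
  have hdc : HasCompactSupport (fderiv ℝ (φ.normed μ)) := hφc.fderiv ℝ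
  have hdcont : Continuous (fderiv ℝ (φ.normed μ)) := hφd.continuous_fderiv (by norm_num)
  have hex : ∀ x, Integrable (fun t => B (φ.normed μ t) (F (x - t))) μ := fun x =>
    hφc.convolutionExists_left B φ.continuous_normed hFl x
  have hex' : ∀ x, Integrable (fun t => B' (fderiv ℝ (φ.normed μ) t) (F (x - t))) μ := fun x =>
    hdc.convolutionExists_left B' hdcont hFl x
  have hdi : Integrable (fun t => ‖fderiv ℝ (φ.normed μ) t‖) μ :=
    (hdcont.integrable_of_hasCompactSupport hdc).norm
  have hFs : ∀ x y t, |F (x - t) - F (y - t)| ≤ L * ‖x - y‖ := fun x y t => by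
    simpa using h (x - t) (y - t)
  have hHlip : ∀ x y, |H x - H y| ≤ L * ‖x - y‖ := by
    intro x y
    have h1 : H x - H y = ∫ t, φ.normed μ t * (F (x - t) - F (y - t)) ∂μ := by
      rw [hH, convolution_def, convolution_def, ← integral_sub (hex x) (hex y)]
      simp [hB, mul_sub]
    rw [h1]
    refine (norm_integral_le_of_norm_le
      (f := fun t => φ.normed μ t * (F (x - t) - F (y - t)))
      (φ.integrable_normed.mul_const (L * ‖x - y‖))
      (Filter.Eventually.of_forall fun t => ?_)).trans_eq ?_
    · rw [norm_mul, Real.norm_of_nonneg (φ.nonneg_normed t)]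
      exact mul_le_mul_of_nonneg_left (hFs x y t) (φ.nonneg_normed t)
    · rw [integral_mul_const, φ.integral_normed, one_mul]
  refine ⟨(∫ t, ‖fderiv ℝ (φ.normed μ) t‖ ∂μ) * L, H, G,
    mul_nonneg (integral_nonneg fun t => norm_nonneg _) hL,
    ⟨hder, fun x => ?_, fun x y => ?_⟩, fun x => ?_⟩
  · exact (hder x).le_of_lip' hL (Filter.Eventually.of_forall fun y => hHlip y x)
  · have h1 : G x - G y =
        ∫ t, B' (fderiv ℝ (φ.normed μ) t) (F (x - t) - F (y - t)) ∂μ := by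
      rw [hG, convolution_def, convolution_def, ← integral_sub (hex' x) (hex' y)]
      simp only [map_sub]
    rw [h1]
    refine (norm_integral_le_of_norm_le
      (f := fun t => B' (fderiv ℝ (φ.normed μ) t) (F (x - t) - F (y - t)))
      (hdi.mul_const (L * ‖x - y‖))
      (Filter.Eventually.of_forall fun t => ?_)).trans_eq ?_
    · exact (hB'le _ _).trans (mul_le_mul_of_nonneg_left (hFs x y t) (norm_nonneg _))
    · rw [integral_mul_const]; ring
  · refine φ.dist_normed_convolution_le hFc.aestronglyMeasurable fun y hy => ?_
    rw [Real.dist_eq]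
    refine (h y x).trans (mul_le_mul_of_nonneg_left ?_ hL)
    rw [← dist_eq_norm]
    exact (Metric.mem_ball.1 hy).le

variable [MeasurableSpace E] [BorelSpace E]

/-- Exponential moments of a Lipschitz function of a Gaussian vector, with the sharp constant. -/
theorem integral_exp_le_of_abs_sub_le {F : E → ℝ} {L : ℝ} (hL : 0 ≤ L)
    (h : ∀ x y, |F x - F y| ≤ L * ‖x - y‖) :
    ∫ z, Real.exp (F z) ∂(stdGaussian E) ≤
      Real.exp ((∫ z, F z ∂(stdGaussian E)) + L ^ 2 / 2) := by
  set γ := stdGaussian E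
  have hFi : Integrable F γ := by simpa using integrable_shift h 0 zero_le_one
  have key : ∀ ε : ℝ, 0 < ε → ∫ z, Real.exp (F z) ∂γ ≤
      Real.exp (∫ z, F z ∂γ + L * ε + L ^ 2 / 2 + L * ε) := by
    intro ε hε
    obtain ⟨M, H, G, hM, hH, hHF⟩ := exists_hasLipschitzGradient_approx hL h hε
    have hHi : Integrable H γ := by simpa using integrable_shift hH.abs_sub_le 0 zero_le_one
    have hHe : Integrable (fun z => Real.exp (H z)) γ := by
      simpa using integrable_exp_shift hH.abs_sub_le 0 zero_le_one
    have hmean : ∫ z, H z ∂γ ≤ ∫ z, F z ∂γ + L * ε := by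
      have : ∫ z, H z ∂γ ≤ ∫ z, (F z + L * ε) ∂γ :=
        integral_mono hHi (hFi.add (integrable_const _)) fun z => by
          have := (abs_le.1 (hHF z)).2
          change H z ≤ F z + L * ε
          linarith
      rwa [integral_add hFi (integrable_const _), integral_const, probReal_univ, one_smul] at this
    calc ∫ z, Real.exp (F z) ∂γ ≤ ∫ z, Real.exp (H z) * Real.exp (L * ε) ∂γ := by
          refine integral_mono_of_nonneg (Filter.Eventually.of_forall fun z =>
            (Real.exp_pos _).le) (hHe.mul_const _) (Filter.Eventually.of_forall fun z => ?_)
          change _ ≤ _ * _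
          rw [← Real.exp_add]
          have := (abs_le.1 (hHF z)).1
          exact Real.exp_le_exp.2 (by linarith)
      _ = (∫ z, Real.exp (H z) ∂γ) * Real.exp (L * ε) := integral_mul_const _ _
      _ ≤ Real.exp (∫ z, H z ∂γ + L ^ 2 / 2) * Real.exp (L * ε) :=
          mul_le_mul_of_nonneg_right (hH.integral_exp_le hL hM) (Real.exp_pos _).le
      _ ≤ _ := by
          rw [← Real.exp_add]
          exact Real.exp_le_exp.2 (by linarith)
  have hlim : Filter.Tendsto (fun ε : ℝ => Real.exp (∫ z, F z ∂γ + L * ε + L ^ 2 / 2 + L * ε))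
      (nhdsWithin 0 (Set.Ioi 0))
      (nhds (Real.exp (∫ z, F z ∂γ + L * 0 + L ^ 2 / 2 + L * 0))) := by
    refine Filter.Tendsto.mono_left (Continuous.tendsto ?_ 0) nhdsWithin_le_nhds
    fun_prop
  simpa using ge_of_tendsto hlim (eventually_mem_nhdsWithin.mono fun ε hε => key ε hε)

/-- The Gaussian concentration inequality. -/
theorem measureReal_add_le_of_abs_sub_le {F : E → ℝ} {L : ℝ} (hL : 0 ≤ L)
    (h : ∀ x y, |F x - F y| ≤ L * ‖x - y‖) {u : ℝ} (hu : 0 ≤ u) :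
    (stdGaussian E).real {z | (∫ z, F z ∂(stdGaussian E)) + u ≤ F z} ≤
      Real.exp (-(u ^ 2 / (2 * L ^ 2))) := by
  set b := ∫ z, F z ∂(stdGaussian E) with hb
  have hlip : ∀ t x y : _, |t * (F x - b) - t * (F y - b)| ≤ (|t| * L) * ‖x - y‖ := by
    intro t x y
    rw [← mul_sub, sub_sub_sub_cancel_right, abs_mul, mul_assoc]
    exact mul_le_mul_of_nonneg_left (h x y) (abs_nonneg t)
  have hFi : Integrable F (stdGaussian E) := by simpa using integrable_shift h 0 zero_le_one
  have hsub : HasSubgaussianMGF (fun z => F z - b) ⟨L ^ 2, sq_nonneg L⟩ (stdGaussian E) := by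
    refine ⟨fun t => ?_, fun t => ?_⟩
    · simpa using integrable_exp_shift (hlip t) 0 zero_le_one
    · have h0 : ∫ z, t * (F z - b) ∂(stdGaussian E) = 0 := by
        rw [integral_const_mul, integral_sub hFi (integrable_const b)]
        simp [hb]
      refine (integral_exp_le_of_abs_sub_le (by positivity) (hlip t)).trans_eq ?_
      rw [h0, mul_pow, sq_abs, zero_add, mul_comm]
      rfl
  have := hsub.measure_ge_le hu
  rw [neg_div] at this
  refine le_trans (le_of_eq ?_) this
  congr 1
  ext z
  simp [le_sub_iff_add_le']

end Smoothing

/-! ### Gaussian vectors: marginals and linear images -/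

section GaussianImages

lemma integral_abs_gaussianReal : ∫ t, |t| ∂(gaussianReal 0 1) = √(2 / Real.pi) := by
  rw [integral_gaussianReal_eq_integral_smul one_ne_zero]
  have h1 : ∀ t : ℝ, gaussianPDFReal 0 1 t • |t| =
      (√(2 * Real.pi))⁻¹ * (|t| ^ (1 : ℝ) * Real.exp (-(1 / 2) * |t| ^ (2 : ℝ))) := by
    intro t
    simp only [gaussianPDFReal, NNReal.coe_one, mul_one, sub_zero, Real.rpow_one, Real.rpow_two,
      sq_abs, smul_eq_mul]
    ring_nf
  simp_rw [h1]
  rw [integral_const_mul,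
    integral_comp_abs (f := fun t : ℝ => t ^ (1 : ℝ) * Real.exp (-(1 / 2) * t ^ (2 : ℝ))),
    integral_rpow_mul_exp_neg_mul_rpow (by norm_num) (by norm_num) (by norm_num)]
  norm_num [Real.Gamma_one]
  have hs : √2 * √2 = (2 : ℝ) := Real.mul_self_sqrt (by norm_num)
  have h2 : √2 ≠ 0 := by positivity
  have h3 : √Real.pi ≠ 0 := by positivity
  field_simp
  linarith

variable {E F : Type*} [NormedAddCommGroup E] [InnerProductSpace ℝ E] [FiniteDimensional ℝ E]
  [MeasurableSpace E] [BorelSpace E] [NormedAddCommGroup F] [InnerProductSpace ℝ F]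
  [FiniteDimensional ℝ F] [MeasurableSpace F] [BorelSpace F]

lemma integral_abs_inner_stdGaussian (y : E) :
    ∫ z, |inner ℝ z y| ∂(stdGaussian E) = √(2 / Real.pi) * ‖y‖ := by
  have h1 := IsGaussian.map_eq_gaussianReal (μ := stdGaussian E) (innerSL ℝ y)
  rw [integral_strongDual_stdGaussian, variance_dual_stdGaussian, innerSL_apply_norm] at h1
  have h2 : gaussianReal 0 (‖y‖ ^ 2).toNNReal = (gaussianReal 0 1).map (‖y‖ * ·) := by
    rw [gaussianReal_map_const_mul, mul_zero, mul_one]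
    congr 1
    ext
    simp
  have h3 : ∫ z, |inner ℝ z y| ∂(stdGaussian E) =
      ∫ t, |t| ∂((stdGaussian E).map (innerSL ℝ y)) := by
    rw [integral_map (by fun_prop) (by fun_prop)]
    simp [real_inner_comm]
  rw [h3, h1, h2, integral_map (by fun_prop) (by fun_prop)]
  simp only [abs_mul, abs_norm]
  rw [integral_const_mul, integral_abs_gaussianReal, mul_comm]

/-- A linear map whose adjoint is isometric sends standard Gaussian vectors to standard Gaussian
vectors. -/
lemma measurePreserving_stdGaussian (T : E →L[ℝ] F) (S : F → E)
    (hTS : ∀ a t, inner ℝ (T a) t = inner ℝ a (S t)) (hS : ∀ t, ‖S t‖ = ‖t‖) :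
    MeasurePreserving T (stdGaussian E) (stdGaussian F) := by
  refine ⟨by fun_prop, ?_⟩
  have : IsProbabilityMeasure ((stdGaussian E).map T) :=
    Measure.isProbabilityMeasure_map (by fun_prop)
  refine Measure.ext_of_charFun ?_
  funext t
  rw [charFun_stdGaussian, ← hS t, ← charFun_stdGaussian (S t), charFun_apply, charFun_apply,
    integral_map (by fun_prop) (by fun_prop)]
  simp_rw [hTS]

end GaussianImages

/-! ### Rademacher averages -/

section Rademacher

variable {ι : Type*}

lemma add_ciSup_le_of_forall [Nonempty ι] {f g : ι → ℝ} {c : ℝ} (h : ∀ s t, f s + g t ≤ c) :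
    (⨆ s, f s) + (⨆ t, g t) ≤ c := by
  have h1 : ∀ t, (⨆ s, f s) ≤ c - g t := fun t => ciSup_le fun s => by linarith [h s t]
  have h2 : (⨆ t, g t) ≤ c - ⨆ s, f s := ciSup_le fun t => by linarith [h1 t]
  linarith

/-- The comparison behind the contraction principle, for a single sign. -/
lemma ciSup_add_abs_add_ciSup_sub_abs_le [Nonempty ι] {a t : ι → ℝ}
    (h1 : BddAbove (Set.range fun x => a x + t x)) (h2 : BddAbove (Set.range fun x => a x - t x)) :
    (⨆ x, (a x + |t x|)) + (⨆ x, (a x - |t x|)) ≤ (⨆ x, (a x + t x)) + ⨆ x, (a x - t x) := by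
  refine add_ciSup_le_of_forall fun x y => ?_
  have hx1 := le_ciSup h1 x
  have hx2 := le_ciSup h2 x
  have hy1 := le_ciSup h1 y
  have hy2 := le_ciSup h2 y
  rcases abs_cases (t x) with ⟨ha, _⟩ | ⟨ha, _⟩ <;>
    rcases abs_cases (t y) with ⟨hb, _⟩ | ⟨hb, _⟩ <;>
    rw [ha, hb] <;> linarith

lemma abs_sign_mul (e : ℤˣ) (r : ℝ) : |((e : ℤ) : ℝ) * r| = |r| := by
  rcases Int.units_eq_one_or e with h | h <;> simp [h]

lemma bddAbove_range_of_abs_le {f : ι → ℝ} {c : ℝ} (h : ∀ x, |f x| ≤ c) :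
    BddAbove (Set.range f) :=
  ⟨c, by rintro _ ⟨x, rfl⟩; exact (abs_le.1 (h x)).2⟩

lemma bddAbove_range_sum_sign {κ : Type*} [Fintype κ] {t : κ → ι → ℝ} {B : ℝ}
    (ht : ∀ i x, |t i x| ≤ B) (ε : κ → ℤˣ) :
    BddAbove (Set.range fun x => ∑ i, ((ε i : ℤ) : ℝ) * t i x) := by
  refine bddAbove_range_of_abs_le (c := ∑ _i : κ, B) fun x => ?_
  refine (Finset.abs_sum_le_sum_abs _ _).trans (Finset.sum_le_sum fun i _ => ?_)
  rw [abs_sign_mul]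
  exact ht i x

variable {κ : Type*} [Fintype κ] [DecidableEq κ]

/-- The contraction principle for the absolute value, one-sided version. -/
lemma sum_ciSup_sign_abs_le [Nonempty ι] {t : κ → ι → ℝ} {B : ℝ} (ht : ∀ i x, |t i x| ≤ B) :
    ∑ ε : κ → ℤˣ, ⨆ x, ∑ i, ((ε i : ℤ) : ℝ) * |t i x| ≤
      ∑ ε : κ → ℤˣ, ⨆ x, ∑ i, ((ε i : ℤ) : ℝ) * t i x := by
  -- `τ s` has the absolute values removed on the coordinates in `s`
  let τ : Finset κ → κ → ι → ℝ := fun s i x => if i ∈ s then t i x else |t i x|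
  have hτ : ∀ s i x, |τ s i x| ≤ B := fun s i x => by
    simp only [τ]
    split_ifs
    · exact ht i x
    · rw [abs_abs]; exact ht i x
  suffices H : ∀ s : Finset κ, ∑ ε : κ → ℤˣ, ⨆ x, ∑ i, ((ε i : ℤ) : ℝ) * |t i x| ≤
      ∑ ε : κ → ℤˣ, ⨆ x, ∑ i, ((ε i : ℤ) : ℝ) * τ s i x by
    simpa [τ] using H Finset.univ
  intro s
  induction s using Finset.induction_on with
  | empty => simp [τ]
  | insert j s hj ih =>
    refine ih.trans ?_
    -- flipping the sign of the coordinate `j` is a bijection on sign vectors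
    let flip : (κ → ℤˣ) ≃ (κ → ℤˣ) := Equiv.mulLeft (Pi.mulSingle j (-1))
    have hsplit : ∀ (s' : Finset κ) (ε : κ → ℤˣ) (x : ι), ∑ i, ((ε i : ℤ) : ℝ) * τ s' i x =
        (∑ i ∈ Finset.univ.erase j, ((ε i : ℤ) : ℝ) * τ s' i x) + ((ε j : ℤ) : ℝ) * τ s' j x :=
      fun s' ε x => (Finset.sum_erase_add _ _ (Finset.mem_univ j)).symm
    have hflipj : ∀ ε : κ → ℤˣ, ((flip ε j : ℤ) : ℝ) = -((ε j : ℤ) : ℝ) := fun ε => by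
      simp [flip]
    have hflip : ∀ (ε : κ → ℤˣ) (i : κ), i ≠ j → flip ε i = ε i := fun ε i hi => by
      simp [flip, Pi.mulSingle_eq_of_ne hi]
    have hdouble : ∀ s' : Finset κ, 2 * ∑ ε : κ → ℤˣ, ⨆ x, ∑ i, ((ε i : ℤ) : ℝ) * τ s' i x =
        ∑ ε : κ → ℤˣ, ((⨆ x, ∑ i, ((ε i : ℤ) : ℝ) * τ s' i x) +
          ⨆ x, ∑ i, ((flip ε i : ℤ) : ℝ) * τ s' i x) := by
      intro s'
      rw [Finset.sum_add_distrib, two_mul]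
      congr 1
      exact (Equiv.sum_comp flip
        (fun ε => ⨆ x, ∑ i, ((ε i : ℤ) : ℝ) * τ s' i x)).symm
    suffices 2 * ∑ ε : κ → ℤˣ, ⨆ x, ∑ i, ((ε i : ℤ) : ℝ) * τ s i x ≤
        2 * ∑ ε : κ → ℤˣ, ⨆ x, ∑ i, ((ε i : ℤ) : ℝ) * τ (insert j s) i x by linarith
    rw [hdouble, hdouble]
    refine Finset.sum_le_sum fun ε _ => ?_
    have hb1 := bddAbove_range_sum_sign (hτ (insert j s)) ε
    have hb2 := bddAbove_range_sum_sign (hτ (insert j s)) (flip ε)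
    set a : ι → ℝ := fun x => ∑ i ∈ Finset.univ.erase j, ((ε i : ℤ) : ℝ) * t i x with ha
    have hrest : ∀ x, ∑ i ∈ Finset.univ.erase j, ((ε i : ℤ) : ℝ) * τ (insert j s) i x =
        ∑ i ∈ Finset.univ.erase j, ((ε i : ℤ) : ℝ) * τ s i x := fun x => by
      refine Finset.sum_congr rfl fun i hi => ?_
      simp [τ, Finset.ne_of_mem_erase hi]
    have hrest' : ∀ (s' : Finset κ) x,
        ∑ i ∈ Finset.univ.erase j, ((flip ε i : ℤ) : ℝ) * τ s' i x =
        ∑ i ∈ Finset.univ.erase j, ((ε i : ℤ) : ℝ) * τ s' i x := fun s' x => by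
      refine Finset.sum_congr rfl fun i hi => ?_
      rw [hflip ε i (Finset.ne_of_mem_erase hi)]
    have hj1 : ∀ x, τ s j x = |t j x| := fun x => by simp [τ, hj]
    have hj2 : ∀ x, τ (insert j s) j x = t j x := fun x => by simp [τ]
    simp only [hsplit, hflipj, hrest', hrest, hj1, hj2] at hb1 hb2 ⊢
    rcases Int.units_eq_one_or (ε j) with h | h
    · simp only [h, Units.val_one, Int.cast_one, one_mul, neg_mul, ← sub_eq_add_neg] at hb1 hb2 ⊢
      exact ciSup_add_abs_add_ciSup_sub_abs_le hb1 hb2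
    · simp only [h, Units.val_neg, Units.val_one, Int.cast_neg, Int.cast_one, neg_neg, one_mul,
        neg_mul, ← sub_eq_add_neg] at hb1 hb2 ⊢
      rw [add_comm, add_comm (⨆ x, _ - t j x)]
      exact ciSup_add_abs_add_ciSup_sub_abs_le hb2 hb1

/-- The contraction principle for the absolute value: Rademacher averages of a set containing the
origin at most double when the coordinates are replaced by their absolute values. -/
lemma sum_ciSup_abs_sign_abs_le {t : κ → ι → ℝ} {B : ℝ} (ht : ∀ i x, |t i x| ≤ B)
    (x₀ : ι) (hx₀ : ∀ i, t i x₀ = 0) :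
    ∑ ε : κ → ℤˣ, ⨆ x, |∑ i, (((ε i : ℤ) : ℝ) * |t i x|)| ≤
      2 * ∑ ε : κ → ℤˣ, ⨆ x, |∑ i, ((ε i : ℤ) : ℝ) * t i x| := by
  have : Nonempty ι := ⟨x₀⟩
  have ht' : ∀ i x, |(|t i x|)| ≤ B := fun i x => by rw [abs_abs]; exact ht i x
  have hneg : ∀ (ε : κ → ℤˣ) (x : ι),
      ∑ i, (((-ε) i : ℤ) : ℝ) * |t i x| = -∑ i, ((ε i : ℤ) : ℝ) * |t i x| := fun ε x => by
    simp [Finset.sum_neg_distrib]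
  have hzero : ∀ ε : κ → ℤˣ, 0 ≤ ⨆ x, ∑ i, ((ε i : ℤ) : ℝ) * |t i x| := fun ε => by
    refine le_ciSup_of_le (bddAbove_range_sum_sign ht' ε) x₀ ?_
    simp [hx₀]
  have h1 : ∀ ε : κ → ℤˣ, ⨆ x, |∑ i, (((ε i : ℤ) : ℝ) * |t i x|)| ≤
      (⨆ x, ∑ i, ((ε i : ℤ) : ℝ) * |t i x|) + ⨆ x, ∑ i, (((-ε) i : ℤ) : ℝ) * |t i x| := by
    intro ε
    refine ciSup_le fun x => abs_le'.2 ⟨?_, ?_⟩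
    · have := le_ciSup (bddAbove_range_sum_sign ht' ε) x
      have := hzero (-ε)
      linarith
    · have := le_ciSup (bddAbove_range_sum_sign ht' (-ε)) x
      have := hzero ε
      rw [← hneg]
      linarith
  have h2 : ∑ ε : κ → ℤˣ, ⨆ x, ∑ i, (((-ε) i : ℤ) : ℝ) * |t i x| =
      ∑ ε : κ → ℤˣ, ⨆ x, ∑ i, ((ε i : ℤ) : ℝ) * |t i x| :=
    Equiv.sum_comp (Equiv.neg (κ → ℤˣ)) (fun ε => ⨆ x, ∑ i, ((ε i : ℤ) : ℝ) * |t i x|)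
  calc ∑ ε : κ → ℤˣ, ⨆ x, |∑ i, (((ε i : ℤ) : ℝ) * |t i x|)|
      ≤ ∑ ε : κ → ℤˣ, ((⨆ x, ∑ i, ((ε i : ℤ) : ℝ) * |t i x|) +
          ⨆ x, ∑ i, (((-ε) i : ℤ) : ℝ) * |t i x|) := Finset.sum_le_sum fun ε _ => h1 ε
    _ = 2 * ∑ ε : κ → ℤˣ, ⨆ x, ∑ i, ((ε i : ℤ) : ℝ) * |t i x| := by
        rw [Finset.sum_add_distrib, h2, two_mul]
    _ ≤ 2 * ∑ ε : κ → ℤˣ, ⨆ x, ∑ i, ((ε i : ℤ) : ℝ) * t i x := by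
        have := sum_ciSup_sign_abs_le ht
        linarith
    _ ≤ _ := by
        refine mul_le_mul_of_nonneg_left (Finset.sum_le_sum fun ε _ => ?_) zero_le_two
        refine ciSup_mono (bddAbove_range_of_abs_le (c := ∑ _i : κ, B) fun x => ?_)
          fun x => le_abs_self _
        rw [abs_abs]
        refine (Finset.abs_sum_le_sum_abs _ _).trans (Finset.sum_le_sum fun i _ => ?_)
        rw [abs_sign_mul]
        exact ht i x

end Rademacher

/-! ### Suprema of Lipschitz families -/

section LipschitzSup

variable {ι : Type*}

lemma abs_ciSup_sub_ciSup_le {f g : ι → ℝ} {c : ℝ} (hc : 0 ≤ c) (hf : BddAbove (Set.range f))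
    (hg : BddAbove (Set.range g)) (h : ∀ i, |f i - g i| ≤ c) :
    |(⨆ i, f i) - ⨆ i, g i| ≤ c := by
  rcases isEmpty_or_nonempty ι with hι | hι
  · simpa [Real.iSup_of_isEmpty] using hc
  rw [abs_sub_le_iff]
  constructor
  · have : ⨆ i, f i ≤ (⨆ i, g i) + c := ciSup_le fun i => by
      linarith [(abs_le.1 (h i)).2, le_ciSup hg i]
    linarith
  · have : ⨆ i, g i ≤ (⨆ i, f i) + c := ciSup_le fun i => by
      linarith [(abs_le.1 (h i)).1, le_ciSup hf i]
    linarith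

variable {W : Type*} [SeminormedAddCommGroup W] {f : ι → W → ℝ} {c B : ℝ}

lemma abs_le_of_lipschitz_family (hf : ∀ i a b, |f i a - f i b| ≤ c * ‖a - b‖)
    (h0 : ∀ i, |f i 0| ≤ B) (a : W) (i : ι) : |f i a| ≤ B + c * ‖a‖ := by
  have h1 := hf i a 0
  rw [sub_zero] at h1
  have h2 := abs_sub_abs_le_abs_sub (f i a) (f i 0)
  linarith [h0 i]

lemma bddAbove_of_lipschitz_family (hf : ∀ i a b, |f i a - f i b| ≤ c * ‖a - b‖)
    (h0 : ∀ i, |f i 0| ≤ B) (a : W) : BddAbove (Set.range fun i => f i a) :=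
  bddAbove_range_of_abs_le (abs_le_of_lipschitz_family hf h0 a)

lemma abs_ciSup_sub_le_of_lipschitz_family (hc : 0 ≤ c)
    (hf : ∀ i a b, |f i a - f i b| ≤ c * ‖a - b‖) (h0 : ∀ i, |f i 0| ≤ B) (a b : W) :
    |(⨆ i, f i a) - ⨆ i, f i b| ≤ c * ‖a - b‖ :=
  abs_ciSup_sub_ciSup_le (by positivity) (bddAbove_of_lipschitz_family hf h0 a)
    (bddAbove_of_lipschitz_family hf h0 b) fun i => hf i a b

end LipschitzSup

/-! ### Gaussian matrices as Gaussian vectors -/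

section Matrices

variable {m n : ℕ}

/-- The linear combination, with coefficients `c`, of the rows of an `m × n` matrix, which is viewed
as a vector indexed by pairs. -/
noncomputable def rowCombination (c : Fin m → ℝ) :
    EuclideanSpace ℝ (Fin m × Fin n) →L[ℝ] EuclideanSpace ℝ (Fin n) :=
  LinearMap.toContinuousLinearMap
    { toFun := fun a => WithLp.toLp 2 fun j => ∑ i, c i * a (i, j)
      map_add' := fun a b => by
        ext j
        simp [mul_add, Finset.sum_add_distrib]
      map_smul' := fun r a => by
        ext j
        simp [Finset.mul_sum, mul_left_comm] }

@[simp] lemma rowCombination_apply (c : Fin m → ℝ) (a : EuclideanSpace ℝ (Fin m × Fin n))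
    (j : Fin n) : rowCombination c a j = ∑ i, c i * a (i, j) := rfl

/-- The `i`-th row of an `m × n` matrix, viewed as a vector indexed by pairs. -/
noncomputable def matrixRow (i : Fin m) :
    EuclideanSpace ℝ (Fin m × Fin n) →L[ℝ] EuclideanSpace ℝ (Fin n) :=
  rowCombination (Pi.single i 1)

@[simp] lemma matrixRow_apply (i : Fin m) (a : EuclideanSpace ℝ (Fin m × Fin n)) (j : Fin n) :
    matrixRow i a j = a (i, j) := by
  simp [matrixRow, Pi.single_apply]

lemma rowCombination_eq_sum (c : Fin m → ℝ) (a : EuclideanSpace ℝ (Fin m × Fin n)) :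
    rowCombination c a = ∑ i, c i • matrixRow i a := by
  ext j
  simp

lemma inner_euclidean_eq_sum {κ : Type*} [Fintype κ] (x y : EuclideanSpace ℝ κ) :
    inner ℝ x y = ∑ j, x j * y j := by
  simp [PiLp.inner_apply, mul_comm]

/-- If the coefficients have Euclidean norm one, the combination of the rows of a Gaussian matrix is
a Gaussian vector. -/
lemma measurePreserving_rowCombination (c : Fin m → ℝ) (hc : ∑ i, c i ^ 2 = 1) :
    MeasurePreserving (rowCombination (n := n) c)
      (stdGaussian (EuclideanSpace ℝ (Fin m × Fin n)))
      (stdGaussian (EuclideanSpace ℝ (Fin n))) := by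
  refine measurePreserving_stdGaussian _ (fun t => WithLp.toLp 2 fun p => c p.1 * t p.2)
    (fun a t => ?_) fun t => ?_
  · rw [inner_euclidean_eq_sum, inner_euclidean_eq_sum, Fintype.sum_prod_type, Finset.sum_comm]
    simp only [rowCombination_apply, Finset.sum_mul]
    exact Finset.sum_congr rfl fun j _ => Finset.sum_congr rfl fun i _ => by ring
  · rw [← sq_eq_sq₀ (norm_nonneg _) (norm_nonneg _), EuclideanSpace.real_norm_sq_eq,
      EuclideanSpace.real_norm_sq_eq, Fintype.sum_prod_type]
    simp only [mul_pow, ← Finset.mul_sum]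
    rw [← Finset.sum_mul, hc, one_mul]

lemma measurePreserving_matrixRow (i : Fin m) :
    MeasurePreserving (matrixRow (n := n) i)
      (stdGaussian (EuclideanSpace ℝ (Fin m × Fin n))) (stdGaussian (EuclideanSpace ℝ (Fin n))) :=
  measurePreserving_rowCombination _ (by simp [Pi.single_apply])

/-- The matrix whose entries are the coordinates of a vector indexed by pairs. -/
noncomputable def matrixOfVector (a : EuclideanSpace ℝ (Fin m × Fin n)) :
    Matrix (Fin m) (Fin n) ℝ :=
  fun i j => a (i, j)

lemma norm_mulVecL1_matrixOfVector (a : EuclideanSpace ℝ (Fin m × Fin n))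
    (x : EuclideanSpace ℝ (Fin n)) :
    ‖mulVecL1 (matrixOfVector a) x‖ = ∑ i, |inner ℝ (matrixRow i a) x| := by
  rw [PiLp.norm_eq_of_L1]
  refine Finset.sum_congr rfl fun i _ => ?_
  rw [Real.norm_eq_abs, inner_euclidean_eq_sum]
  simp [mulVecL1, Matrix.toLpLin_apply, Matrix.mulVec, dotProduct, matrixOfVector]

lemma sum_norm_matrixRow_le (a : EuclideanSpace ℝ (Fin m × Fin n)) :
    ∑ i, ‖matrixRow i a‖ ≤ √(m : ℝ) * ‖a‖ := by
  have h1 : (∑ i, ‖matrixRow i a‖) ^ 2 ≤ (m : ℝ) * ∑ i, ‖matrixRow i a‖ ^ 2 := by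
    simpa using sq_sum_le_card_mul_sum_sq (s := (Finset.univ : Finset (Fin m)))
      (f := fun i => ‖matrixRow i a‖)
  have h2 : ∑ i, ‖matrixRow i a‖ ^ 2 = ‖a‖ ^ 2 := by
    simp [EuclideanSpace.real_norm_sq_eq, Fintype.sum_prod_type]
  rw [h2] at h1
  refine (sq_le_sq₀ (Finset.sum_nonneg fun i _ => norm_nonneg _) (by positivity)).1 ?_
  rwa [mul_pow, Real.sq_sqrt (Nat.cast_nonneg m)]

lemma sum_abs_inner_matrixRow_le (a : EuclideanSpace ℝ (Fin m × Fin n))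
    {x : EuclideanSpace ℝ (Fin n)} {D : ℝ} (hx : ‖x‖ ≤ D) :
    ∑ i, |inner ℝ (matrixRow i a) x| ≤ √(m : ℝ) * D * ‖a‖ := by
  have hD : 0 ≤ D := (norm_nonneg x).trans hx
  calc ∑ i, |inner ℝ (matrixRow i a) x| ≤ ∑ i, ‖matrixRow i a‖ * D :=
        Finset.sum_le_sum fun i _ => (abs_real_inner_le_norm _ _).trans (by gcongr)
    _ = (∑ i, ‖matrixRow i a‖) * D := (Finset.sum_mul _ _ _).symm
    _ ≤ √(m : ℝ) * ‖a‖ * D := mul_le_mul_of_nonneg_right (sum_norm_matrixRow_le a) hD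
    _ = _ := by ring

/-- Any signed sum of the functions `a ↦ |⟨aᵢ, x⟩|` of the rows is Lipschitz. -/
lemma abs_sum_sign_abs_inner_sub_le (ε : Fin m → ℤˣ) (a b : EuclideanSpace ℝ (Fin m × Fin n))
    {x : EuclideanSpace ℝ (Fin n)} {D : ℝ} (hx : ‖x‖ ≤ D) :
    |(∑ i, ((ε i : ℤ) : ℝ) * |inner ℝ (matrixRow i a) x|) -
      ∑ i, (((ε i : ℤ) : ℝ) * |inner ℝ (matrixRow i b) x|)| ≤ √(m : ℝ) * D * ‖a - b‖ := by
  rw [← Finset.sum_sub_distrib]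
  refine (Finset.abs_sum_le_sum_abs _ _).trans
    (le_trans (Finset.sum_le_sum fun i _ => ?_) (sum_abs_inner_matrixRow_le (a - b) hx))
  rw [← mul_sub, abs_sign_mul, map_sub, inner_sub_left]
  exact abs_abs_sub_abs_le _ _

/-- Exchanging, in a pair of matrices, the rows `i` with `ε i = -1`. -/
noncomputable def swapRows (ε : Fin m → ℤˣ)
    (p : EuclideanSpace ℝ (Fin m × Fin n) × EuclideanSpace ℝ (Fin m × Fin n)) :
    EuclideanSpace ℝ (Fin m × Fin n) × EuclideanSpace ℝ (Fin m × Fin n) :=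
  (WithLp.toLp 2 fun k => if ε k.1 = 1 then p.1 k else p.2 k,
    WithLp.toLp 2 fun k => if ε k.1 = 1 then p.2 k else p.1 k)

lemma measurePreserving_swapRows (ε : Fin m → ℤˣ) :
    MeasurePreserving (swapRows (n := n) ε)
      ((stdGaussian _).prod (stdGaussian _)) ((stdGaussian _).prod (stdGaussian _)) := by
  let ι := Fin m × Fin n
  let π : Measure (ι → ℝ) := Measure.pi fun _ => gaussianReal 0 1
  have hlp : MeasurePreserving (WithLp.toLp 2) π (stdGaussian (EuclideanSpace ℝ ι)) :=
    ⟨by fun_prop, map_pi_eq_stdGaussian⟩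
  have hlp' : MeasurePreserving (MeasurableEquiv.toLp 2 (ι → ℝ)).symm
      (stdGaussian (EuclideanSpace ℝ ι)) π :=
    MeasurePreserving.symm (MeasurableEquiv.toLp 2 (ι → ℝ)) hlp
  have harrow := measurePreserving_arrowProdEquivProdArrow ℝ ℝ ι
    (fun _ => gaussianReal 0 1) (fun _ => gaussianReal 0 1)
  have hswap : MeasurePreserving
      (fun (q : ι → ℝ × ℝ) k => (if ε k.1 = 1 then id else Prod.swap) (q k))
      (Measure.pi fun _ => (gaussianReal 0 1).prod (gaussianReal 0 1))
      (Measure.pi fun _ => (gaussianReal 0 1).prod (gaussianReal 0 1)) := by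
    refine measurePreserving_pi _ _ (f := fun k : ι => if ε k.1 = 1 then id else Prod.swap)
      fun k => ?_
    split_ifs
    · exact MeasurePreserving.id _
    · exact Measure.measurePreserving_swap
  have := (hlp.prod hlp).comp (harrow.comp (hswap.comp
    ((harrow.symm _).comp (hlp'.prod hlp'))))
  convert this using 1
  funext p
  refine Prod.ext ?_ ?_ <;> ext k <;> by_cases h : ε k.1 = 1 <;>
    simp [swapRows, h, MeasurableEquiv.arrowProdEquivProdArrow, Equiv.arrowProdEquivProdArrow]

end Matrices

/-! ### The expected deviation -/

section Deviation

variable {m n : ℕ} {K : Set (EuclideanSpace ℝ (Fin n))} {D : ℝ}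

lemma inv_natCast_mul_sqrt (hm : 1 ≤ m) : (m : ℝ)⁻¹ * √(m : ℝ) = (√(m : ℝ))⁻¹ := by
  have h : 0 < √(m : ℝ) := Real.sqrt_pos.2 (by exact_mod_cast hm)
  have h2 : √(m : ℝ) * √(m : ℝ) = m := Real.mul_self_sqrt (Nat.cast_nonneg m)
  nth_rewrite 1 [← h2]
  field_simp

lemma l1Deviation_matrixOfVector (a : EuclideanSpace ℝ (Fin m × Fin n)) :
    l1Deviation K (matrixOfVector a) =
      ⨆ x : K, |(m : ℝ)⁻¹ * (∑ i, |inner ℝ (matrixRow i a) (x : EuclideanSpace ℝ (Fin n))|) -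
        √(2 / Real.pi) * ‖(x : EuclideanSpace ℝ (Fin n))‖| := by
  simp only [l1Deviation, norm_mulVecL1_matrixOfVector]

lemma abs_deviation_sub_le (hm : 1 ≤ m) (a b : EuclideanSpace ℝ (Fin m × Fin n))
    {x : EuclideanSpace ℝ (Fin n)} (hx : ‖x‖ ≤ D) :
    |(|(m : ℝ)⁻¹ * (∑ i, |inner ℝ (matrixRow i a) x|) - √(2 / Real.pi) * ‖x‖| -
      |(m : ℝ)⁻¹ * (∑ i, |inner ℝ (matrixRow i b) x|) - √(2 / Real.pi) * ‖x‖|)| ≤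
        D / √(m : ℝ) * ‖a - b‖ := by
  refine (abs_abs_sub_abs_le _ _).trans ?_
  rw [sub_sub_sub_cancel_right, ← mul_sub, abs_mul, abs_of_nonneg (by positivity)]
  have h := abs_sum_sign_abs_inner_sub_le (fun _ => 1) a b hx
  simp only [Units.val_one, Int.cast_one, one_mul] at h
  refine (mul_le_mul_of_nonneg_left h (by positivity)).trans_eq ?_
  rw [← mul_assoc, ← mul_assoc, inv_natCast_mul_sqrt hm]
  ring

lemma deviation_zero_le {x : EuclideanSpace ℝ (Fin n)} (hx : ‖x‖ ≤ D) :
    |(|(m : ℝ)⁻¹ * (∑ i, |inner ℝ (matrixRow i (0 : EuclideanSpace ℝ (Fin m × Fin n))) x|) -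
      √(2 / Real.pi) * ‖x‖|)| ≤ √(2 / Real.pi) * D := by
  simp only [map_zero, inner_zero_left, abs_zero, Finset.sum_const_zero, mul_zero, zero_sub,
    abs_neg, abs_abs]
  rw [abs_of_nonneg (by positivity)]
  gcongr

/-- The deviation is a Lipschitz function of the matrix, for the Frobenius norm. -/
lemma abs_l1Deviation_sub_le (hm : 1 ≤ m) (hD : 0 ≤ D) (hK : ∀ x ∈ K, ‖x‖ ≤ D)
    (a b : EuclideanSpace ℝ (Fin m × Fin n)) :
    |l1Deviation K (matrixOfVector a) - l1Deviation K (matrixOfVector b)| ≤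
      D / √(m : ℝ) * ‖a - b‖ := by
  simp only [l1Deviation_matrixOfVector]
  exact abs_ciSup_sub_le_of_lipschitz_family (B := √(2 / Real.pi) * D)
    (f := fun (x : K) a =>
      |(m : ℝ)⁻¹ * (∑ i, |inner ℝ (matrixRow i a) (x : EuclideanSpace ℝ (Fin n))|) -
        √(2 / Real.pi) * ‖(x : EuclideanSpace ℝ (Fin n))‖|) (by positivity)
    (fun x a b => abs_deviation_sub_le hm a b (hK x x.2))
    (fun x => deviation_zero_le (hK x x.2)) a b

lemma bddAbove_deviation (hm : 1 ≤ m) (hK : ∀ x ∈ K, ‖x‖ ≤ D)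
    (a : EuclideanSpace ℝ (Fin m × Fin n)) :
    BddAbove (Set.range fun x : K =>
      |(m : ℝ)⁻¹ * (∑ i, |inner ℝ (matrixRow i a) (x : EuclideanSpace ℝ (Fin n))|) -
        √(2 / Real.pi) * ‖(x : EuclideanSpace ℝ (Fin n))‖|) :=
  bddAbove_of_lipschitz_family
    (f := fun (x : K) a =>
      |(m : ℝ)⁻¹ * (∑ i, |inner ℝ (matrixRow i a) (x : EuclideanSpace ℝ (Fin n))|) -
        √(2 / Real.pi) * ‖(x : EuclideanSpace ℝ (Fin n))‖|)
    (fun x a b => abs_deviation_sub_le hm a b (hK x x.2))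
    (fun x => deviation_zero_le (hK x x.2)) a

lemma integrable_l1Deviation (hm : 1 ≤ m) (hD : 0 ≤ D) (hK : ∀ x ∈ K, ‖x‖ ≤ D) :
    Integrable (fun a : EuclideanSpace ℝ (Fin m × Fin n) => l1Deviation K (matrixOfVector a))
      (stdGaussian _) := by
  simpa using integrable_shift (abs_l1Deviation_sub_le hm hD hK) 0 zero_le_one

lemma abs_iSup_abs_inner_sub_le (hD : 0 ≤ D) (hK : ∀ x ∈ K, ‖x‖ ≤ D)
    (g h : EuclideanSpace ℝ (Fin n)) :
    |(⨆ x : K, |inner ℝ g (x : EuclideanSpace ℝ (Fin n))|) -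
      (⨆ x : K, |inner ℝ h (x : EuclideanSpace ℝ (Fin n))|)| ≤ D * ‖g - h‖ := by
  refine abs_ciSup_sub_le_of_lipschitz_family (B := 0) (W := EuclideanSpace ℝ (Fin n))
    (f := fun (x : K) g => |inner ℝ g (x : EuclideanSpace ℝ (Fin n))|) hD (fun x g h => ?_)
    (fun x => by simp) g h
  refine (abs_abs_sub_abs_le _ _).trans ?_
  rw [← inner_sub_left, mul_comm]
  exact (abs_real_inner_le_norm _ _).trans
    (mul_le_mul_of_nonneg_left (hK x x.2) (norm_nonneg _))

lemma bddAbove_abs_inner (hK : ∀ x ∈ K, ‖x‖ ≤ D) (g : EuclideanSpace ℝ (Fin n)) :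
    BddAbove (Set.range fun x : K => |inner ℝ g (x : EuclideanSpace ℝ (Fin n))|) :=
  bddAbove_range_of_abs_le (c := ‖g‖ * D) fun x => by
    rw [abs_abs]
    exact (abs_real_inner_le_norm _ _).trans
      (mul_le_mul_of_nonneg_left (hK x x.2) (norm_nonneg _))

lemma integrable_iSup_abs_inner (hD : 0 ≤ D) (hK : ∀ x ∈ K, ‖x‖ ≤ D) :
    Integrable (fun g => ⨆ x : K, |inner ℝ g (x : EuclideanSpace ℝ (Fin n))|)
      (stdGaussian (EuclideanSpace ℝ (Fin n))) := by
  simpa using integrable_shift (abs_iSup_abs_inner_sub_le hD hK) 0 zero_le_one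

/-- The supremum over `K` of a signed sum of the functions `a ↦ |⟨aᵢ, x⟩|` of the rows. -/
noncomputable def signedSup (K : Set (EuclideanSpace ℝ (Fin n))) (ε : Fin m → ℤˣ)
    (a : EuclideanSpace ℝ (Fin m × Fin n)) : ℝ :=
  ⨆ x : K, |∑ i, (((ε i : ℤ) : ℝ) * |inner ℝ (matrixRow i a) (x : EuclideanSpace ℝ (Fin n))|)|

/-- The symmetrized version of `signedSup` for a pair of matrices. -/
noncomputable def signedSupDiff (K : Set (EuclideanSpace ℝ (Fin n))) (ε : Fin m → ℤˣ)
    (p : EuclideanSpace ℝ (Fin m × Fin n) × EuclideanSpace ℝ (Fin m × Fin n)) : ℝ :=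
  ⨆ x : K, |(∑ i, (((ε i : ℤ) : ℝ) * |inner ℝ (matrixRow i p.1) (x : EuclideanSpace ℝ (Fin n))|)) -
    ∑ i, (((ε i : ℤ) : ℝ) * |inner ℝ (matrixRow i p.2) (x : EuclideanSpace ℝ (Fin n))|)|

lemma abs_abs_sum_sign_sub_le (hK : ∀ x ∈ K, ‖x‖ ≤ D) (ε : Fin m → ℤˣ) (x : K)
    (a b : EuclideanSpace ℝ (Fin m × Fin n)) :
    |(|∑ i, (((ε i : ℤ) : ℝ) * |inner ℝ (matrixRow i a) (x : EuclideanSpace ℝ (Fin n))|)| -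
      |∑ i, (((ε i : ℤ) : ℝ) * |inner ℝ (matrixRow i b) (x : EuclideanSpace ℝ (Fin n))|)|)| ≤
        √(m : ℝ) * D * ‖a - b‖ :=
  (abs_abs_sub_abs_le _ _).trans (abs_sum_sign_abs_inner_sub_le ε a b (hK x x.2))

lemma integrable_signedSup (hD : 0 ≤ D) (hK : ∀ x ∈ K, ‖x‖ ≤ D) (ε : Fin m → ℤˣ) :
    Integrable (signedSup K ε) (stdGaussian _) := by
  have h : ∀ a b, |signedSup K ε a - signedSup K ε b| ≤ √(m : ℝ) * D * ‖a - b‖ :=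
    abs_ciSup_sub_le_of_lipschitz_family (B := 0) (by positivity)
      (abs_abs_sum_sign_sub_le hK ε) (fun x => by simp)
  simpa using integrable_shift h 0 zero_le_one

lemma le_signedSup (hK : ∀ x ∈ K, ‖x‖ ≤ D) (ε : Fin m → ℤˣ)
    (a : EuclideanSpace ℝ (Fin m × Fin n)) (x : K) :
    |∑ i, (((ε i : ℤ) : ℝ) * |inner ℝ (matrixRow i a) (x : EuclideanSpace ℝ (Fin n))|)| ≤
      signedSup K ε a :=
  le_ciSup (bddAbove_of_lipschitz_family (B := 0) (abs_abs_sum_sign_sub_le hK ε)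
    (fun x => by simp) a) x

lemma abs_signedSumDiff_sub_le (hD : 0 ≤ D) (hK : ∀ x ∈ K, ‖x‖ ≤ D) (ε : Fin m → ℤˣ) (x : K)
    (p q : EuclideanSpace ℝ (Fin m × Fin n) × EuclideanSpace ℝ (Fin m × Fin n)) :
    |(|(∑ i, (((ε i : ℤ) : ℝ) * |inner ℝ (matrixRow i p.1) (x : EuclideanSpace ℝ (Fin n))|)) -
        ∑ i, (((ε i : ℤ) : ℝ) * |inner ℝ (matrixRow i p.2) (x : EuclideanSpace ℝ (Fin n))|)| -
      |(∑ i, (((ε i : ℤ) : ℝ) * |inner ℝ (matrixRow i q.1) (x : EuclideanSpace ℝ (Fin n))|)) -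
        ∑ i, (((ε i : ℤ) : ℝ) * |inner ℝ (matrixRow i q.2) (x : EuclideanSpace ℝ (Fin n))|)|)| ≤
      2 * (√(m : ℝ) * D) * ‖p - q‖ := by
  have h1 := abs_sum_sign_abs_inner_sub_le ε p.1 q.1 (hK x x.2)
  have h2 := abs_sum_sign_abs_inner_sub_le ε p.2 q.2 (hK x x.2)
  have h3 : √(m : ℝ) * D * ‖p.1 - q.1‖ ≤ √(m : ℝ) * D * ‖p - q‖ :=
    mul_le_mul_of_nonneg_left (norm_fst_le (p - q)) (by positivity)
  have h4 : √(m : ℝ) * D * ‖p.2 - q.2‖ ≤ √(m : ℝ) * D * ‖p - q‖ :=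
    mul_le_mul_of_nonneg_left (norm_snd_le (p - q)) (by positivity)
  refine (abs_abs_sub_abs_le _ _).trans ?_
  rw [sub_sub_sub_comm]
  refine (abs_sub _ _).trans ?_
  linarith

lemma bddAbove_signedSumDiff (hD : 0 ≤ D) (hK : ∀ x ∈ K, ‖x‖ ≤ D) (ε : Fin m → ℤˣ)
    (p : EuclideanSpace ℝ (Fin m × Fin n) × EuclideanSpace ℝ (Fin m × Fin n)) :
    BddAbove (Set.range fun x : K =>
      |(∑ i, (((ε i : ℤ) : ℝ) * |inner ℝ (matrixRow i p.1) (x : EuclideanSpace ℝ (Fin n))|)) -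
        ∑ i, (((ε i : ℤ) : ℝ) * |inner ℝ (matrixRow i p.2) (x : EuclideanSpace ℝ (Fin n))|)|) :=
  bddAbove_of_lipschitz_family (B := 0) (abs_signedSumDiff_sub_le hD hK ε) (fun x => by simp) p

lemma signedSupDiff_nonneg (ε : Fin m → ℤˣ)
    (p : EuclideanSpace ℝ (Fin m × Fin n) × EuclideanSpace ℝ (Fin m × Fin n)) :
    0 ≤ signedSupDiff K ε p := Real.iSup_nonneg fun _ => abs_nonneg _

lemma signedSupDiff_le (hK : ∀ x ∈ K, ‖x‖ ≤ D) (ε : Fin m → ℤˣ)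
    (p : EuclideanSpace ℝ (Fin m × Fin n) × EuclideanSpace ℝ (Fin m × Fin n)) :
    signedSupDiff K ε p ≤ signedSup K ε p.1 + signedSup K ε p.2 := by
  refine Real.iSup_le (fun x => (abs_sub _ _).trans
    (add_le_add (le_signedSup hK ε p.1 x) (le_signedSup hK ε p.2 x))) (add_nonneg ?_ ?_) <;>
  exact Real.iSup_nonneg fun _ => abs_nonneg _

lemma integrable_signedSupDiff (hD : 0 ≤ D) (hK : ∀ x ∈ K, ‖x‖ ≤ D) (ε : Fin m → ℤˣ) :
    Integrable (signedSupDiff K ε) ((stdGaussian (EuclideanSpace ℝ (Fin m × Fin n))).prod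
      (stdGaussian (EuclideanSpace ℝ (Fin m × Fin n)))) := by
  have h : ∀ p q, |signedSupDiff K ε p - signedSupDiff K ε q| ≤
      2 * (√(m : ℝ) * D) * ‖p - q‖ :=
    abs_ciSup_sub_le_of_lipschitz_family (B := 0) (by positivity)
      (abs_signedSumDiff_sub_le hD hK ε) (fun x => by simp)
  have hi := integrable_signedSup hD hK ε
  refine ((hi.comp_fst _).add (hi.comp_snd _)).mono'
    (continuous_of_abs_sub_le h).aestronglyMeasurable (Filter.Eventually.of_forall fun p => ?_)
  rw [Real.norm_of_nonneg (signedSupDiff_nonneg ε p)]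
  exact signedSupDiff_le hK ε p

lemma signedSupDiff_swapRows (ε : Fin m → ℤˣ)
    (p : EuclideanSpace ℝ (Fin m × Fin n) × EuclideanSpace ℝ (Fin m × Fin n)) :
    signedSupDiff K 1 (swapRows ε p) = signedSupDiff K ε p := by
  refine iSup_congr fun x => ?_
  rw [← Finset.sum_sub_distrib, ← Finset.sum_sub_distrib]
  congr 1
  refine Finset.sum_congr rfl fun i _ => ?_
  have h1 : matrixRow i (swapRows ε p).1 =
      if ε i = 1 then matrixRow i p.1 else matrixRow i p.2 := by
    ext j; by_cases h : ε i = 1 <;> simp [swapRows, h]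
  have h2 : matrixRow i (swapRows ε p).2 =
      if ε i = 1 then matrixRow i p.2 else matrixRow i p.1 := by
    ext j; by_cases h : ε i = 1 <;> simp [swapRows, h]
  rw [h1, h2]
  rcases Int.units_eq_one_or (ε i) with h | h
  · simp [h]
  · simp [h, neg_add_eq_sub]

/-- Symmetrization, first half: the centering `√(2/π) ‖x‖` is the mean of `m⁻¹ ‖A' x‖₁` for an
independent copy `A'`, so that the mean deviation is at most the mean of the supremum of the
difference of the two copies. -/
lemma integral_l1Deviation_le_signedSupDiff (hm : 1 ≤ m) (hD : 0 ≤ D)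
    (hK : ∀ x ∈ K, ‖x‖ ≤ D) :
    ∫ a, l1Deviation K (matrixOfVector a) ∂(stdGaussian (EuclideanSpace ℝ (Fin m × Fin n))) ≤
      (m : ℝ)⁻¹ * ∫ p, signedSupDiff K (1 : Fin m → ℤˣ) p
        ∂((stdGaussian _).prod (stdGaussian _)) := by
  set γ := stdGaussian (EuclideanSpace ℝ (Fin m × Fin n))
  have hW := integrable_signedSupDiff (m := m) hD hK 1
  have hm0 : (m : ℝ) ≠ 0 := by positivity
  rw [integral_prod _ hW, ← integral_const_mul]
  have hae := hW.prod_right_ae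
  refine integral_mono_ae (integrable_l1Deviation hm hD hK) (hW.integral_prod_left.const_mul _) ?_
  filter_upwards [hae] with a ha
  rw [l1Deviation_matrixOfVector]
  refine Real.iSup_le (fun x => ?_) (mul_nonneg (by positivity)
    (integral_nonneg fun p => signedSupDiff_nonneg 1 _))
  have hrow : ∀ i : Fin m,
      Integrable (fun b => |inner ℝ (matrixRow i b) (x : EuclideanSpace ℝ (Fin n))|) γ :=
      fun i => by
    have h := integrable_shift (E := EuclideanSpace ℝ (Fin n))
      (L := ‖(x : EuclideanSpace ℝ (Fin n))‖)
      (F := fun g => |inner ℝ g (x : EuclideanSpace ℝ (Fin n))|) (fun g h => by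
        refine (abs_abs_sub_abs_le _ _).trans ?_
        rw [← inner_sub_left, mul_comm]
        exact abs_real_inner_le_norm _ _) 0 zero_le_one
    simp only [zero_add, one_smul] at h
    exact (measurePreserving_matrixRow i).integrable_comp_of_integrable h
  have hmean : ∀ i : Fin m,
      ∫ b, |inner ℝ (matrixRow i b) (x : EuclideanSpace ℝ (Fin n))| ∂γ =
        √(2 / Real.pi) * ‖(x : EuclideanSpace ℝ (Fin n))‖ := fun i => by
    rw [← integral_abs_inner_stdGaussian, ← (measurePreserving_matrixRow (m := m) i).map_eq,
      integral_map (by fun_prop) (by fun_prop)]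
  have hsum : Integrable (fun b => ∑ i : Fin m,
      |inner ℝ (matrixRow i b) (x : EuclideanSpace ℝ (Fin n))|) γ :=
    integrable_finsetSum _ fun i _ => hrow i
  have heq : (m : ℝ)⁻¹ * (∑ i, |inner ℝ (matrixRow i a) (x : EuclideanSpace ℝ (Fin n))|) -
      √(2 / Real.pi) * ‖(x : EuclideanSpace ℝ (Fin n))‖ = (m : ℝ)⁻¹ *
        ∫ b, ((∑ i, |inner ℝ (matrixRow i a) (x : EuclideanSpace ℝ (Fin n))|) -
          ∑ i, |inner ℝ (matrixRow i b) (x : EuclideanSpace ℝ (Fin n))|) ∂γ := by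
    rw [integral_sub (integrable_const _) hsum, integral_finsetSum _ fun i _ => hrow i]
    simp only [hmean, integral_const, probReal_univ, one_smul, Finset.sum_const, Finset.card_univ,
      Fintype.card_fin, nsmul_eq_mul]
    rw [mul_sub, inv_mul_cancel_left₀ hm0]
  rw [heq, abs_mul, abs_of_nonneg (by positivity : (0 : ℝ) ≤ (m : ℝ)⁻¹)]
  refine mul_le_mul_of_nonneg_left ?_ (by positivity)
  refine norm_integral_le_of_norm_le
    (f := fun b => (∑ i, |inner ℝ (matrixRow i a) (x : EuclideanSpace ℝ (Fin n))|) -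
      ∑ i, |inner ℝ (matrixRow i b) (x : EuclideanSpace ℝ (Fin n))|) ha
      (Filter.Eventually.of_forall fun b => ?_)
  have := le_ciSup (bddAbove_signedSumDiff hD hK (1 : Fin m → ℤˣ) (a, b)) x
  simpa [signedSupDiff] using this

/-- Symmetrization, second half: exchanging rows of the two copies introduces arbitrary signs. -/
lemma integral_l1Deviation_le_signedSup (hm : 1 ≤ m) (hD : 0 ≤ D)
    (hK : ∀ x ∈ K, ‖x‖ ≤ D) (ε : Fin m → ℤˣ) :
    ∫ a, l1Deviation K (matrixOfVector a) ∂(stdGaussian (EuclideanSpace ℝ (Fin m × Fin n))) ≤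
      (m : ℝ)⁻¹ * (2 * ∫ a, signedSup K ε a ∂(stdGaussian (EuclideanSpace ℝ (Fin m × Fin n)))) := by
  set γ := stdGaussian (EuclideanSpace ℝ (Fin m × Fin n))
  refine (integral_l1Deviation_le_signedSupDiff hm hD hK).trans
    (mul_le_mul_of_nonneg_left ?_ (by positivity))
  have hsw := measurePreserving_swapRows (n := n) ε
  have h1 : ∫ p, signedSupDiff K (1 : Fin m → ℤˣ) p ∂(γ.prod γ) =
      ∫ p, signedSupDiff K ε p ∂(γ.prod γ) := by
    have h := integral_map (f := signedSupDiff K (1 : Fin m → ℤˣ)) hsw.aemeasurable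
      (by rw [hsw.map_eq]; exact (integrable_signedSupDiff hD hK 1).1)
    rw [hsw.map_eq] at h
    simpa only [signedSupDiff_swapRows] using h
  have hi := integrable_signedSup (m := m) hD hK ε
  rw [h1]
  refine (integral_mono (integrable_signedSupDiff hD hK ε)
    ((hi.comp_fst γ).add (hi.comp_snd γ)) (signedSupDiff_le hK ε)).trans_eq ?_
  simp only [Pi.add_apply]
  rw [integral_add (hi.comp_fst γ) (hi.comp_snd γ),
    integral_fun_fst (μ := γ) (ν := γ) (signedSup K ε),
    integral_fun_snd (μ := γ) (ν := γ) (signedSup K ε)]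
  simp [two_mul]

lemma integral_iSup_rowCombination (hm : 1 ≤ m) (hD : 0 ≤ D) (hK : ∀ x ∈ K, ‖x‖ ≤ D)
    (ε : Fin m → ℤˣ) :
    ∫ a, (⨆ x : K, |∑ i, ((ε i : ℤ) : ℝ) *
        inner ℝ (matrixRow i a) (x : EuclideanSpace ℝ (Fin n))|)
      ∂(stdGaussian (EuclideanSpace ℝ (Fin m × Fin n))) = √(m : ℝ) * gaussianMeanWidth K := by
  have hs : 0 < √(m : ℝ) := Real.sqrt_pos.2 (by exact_mod_cast hm)
  let c : Fin m → ℝ := fun i => (√(m : ℝ))⁻¹ * ((ε i : ℤ) : ℝ)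
  have hc : ∑ i, c i ^ 2 = 1 := by
    have h1 : ∀ i, c i ^ 2 = (m : ℝ)⁻¹ := fun i => by
      rcases Int.units_eq_one_or (ε i) with h | h <;>
        simp [c, h, Real.sq_sqrt (Nat.cast_nonneg m)]
    have hm0 : (m : ℝ) ≠ 0 := by positivity
    simp [h1, hm0]
  have hmp := measurePreserving_rowCombination (n := n) c hc
  have h := integral_map (f := fun g => ⨆ x : K, |inner ℝ g (x : EuclideanSpace ℝ (Fin n))|)
    hmp.aemeasurable (by rw [hmp.map_eq]; exact (integrable_iSup_abs_inner hD hK).1)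
  rw [hmp.map_eq] at h
  rw [gaussianMeanWidth, h, ← integral_const_mul]
  congr 1
  funext a
  rw [Real.mul_iSup_of_nonneg hs.le]
  refine iSup_congr fun x => ?_
  rw [rowCombination_eq_sum, sum_inner]
  nth_rewrite 1 [← abs_of_pos hs]
  rw [← abs_mul, Finset.mul_sum]
  congr 1
  refine Finset.sum_congr rfl fun i _ => ?_
  simp only [c, real_inner_smul_left]
  field_simp

/-- Averaging the symmetrized bound over all signs and applying the contraction principle, which
needs a set containing the origin; the origin may be added to `K` by
`l1Deviation_le_insert_zero` and `gaussianMeanWidth_insert_zero_le`. -/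
lemma integral_l1Deviation_le_of_zero_mem (hm : 1 ≤ m) (hD : 0 ≤ D)
    (hK : ∀ x ∈ K, ‖x‖ ≤ D) (h0 : (0 : EuclideanSpace ℝ (Fin n)) ∈ K) :
    ∫ a, l1Deviation K (matrixOfVector a) ∂(stdGaussian (EuclideanSpace ℝ (Fin m × Fin n))) ≤
      4 * gaussianMeanWidth K / √(m : ℝ) := by
  set γ := stdGaussian (EuclideanSpace ℝ (Fin m × Fin n))
  set I := ∫ a, l1Deviation K (matrixOfVector a) ∂γ
  set N : ℝ := ((Fintype.card (Fin m → ℤˣ) : ℕ) : ℝ) with hN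
  have hNpos : 0 < N := by
    rw [hN]; exact_mod_cast Fintype.card_pos
  have hint : ∀ ε : Fin m → ℤˣ, Integrable (fun a => ⨆ x : K, |∑ i, ((ε i : ℤ) : ℝ) *
        inner ℝ (matrixRow i a) (x : EuclideanSpace ℝ (Fin n))|) γ := fun ε => by
    have h : ∀ a b : EuclideanSpace ℝ (Fin m × Fin n),
        |(⨆ x : K, |∑ i, ((ε i : ℤ) : ℝ) *
            inner ℝ (matrixRow i a) (x : EuclideanSpace ℝ (Fin n))|) -
          (⨆ x : K, |∑ i, ((ε i : ℤ) : ℝ) *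
            inner ℝ (matrixRow i b) (x : EuclideanSpace ℝ (Fin n))|)| ≤
          √(m : ℝ) * D * ‖a - b‖ := by
      refine abs_ciSup_sub_le_of_lipschitz_family (B := 0) (W := EuclideanSpace ℝ (Fin m × Fin n))
        (f := fun (x : K) a => |∑ i, ((ε i : ℤ) : ℝ) *
          inner ℝ (matrixRow i a) (x : EuclideanSpace ℝ (Fin n))|) (by positivity)
        (fun x a b => ?_) (fun x => by simp)
      refine (abs_abs_sub_abs_le _ _).trans ?_
      rw [← Finset.sum_sub_distrib]
      refine (Finset.abs_sum_le_sum_abs _ _).trans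
        (le_trans (Finset.sum_le_sum fun i _ => ?_)
          (sum_abs_inner_matrixRow_le (a - b) (hK x x.2)))
      rw [← mul_sub, abs_sign_mul, map_sub, inner_sub_left]
    simpa using integrable_shift h 0 zero_le_one
  have hcontr : ∀ a : EuclideanSpace ℝ (Fin m × Fin n), ∑ ε : Fin m → ℤˣ, signedSup K ε a ≤
      2 * ∑ ε : Fin m → ℤˣ, ⨆ x : K, |∑ i, ((ε i : ℤ) : ℝ) *
        inner ℝ (matrixRow i a) (x : EuclideanSpace ℝ (Fin n))| := fun a => by
    refine sum_ciSup_abs_sign_abs_le (ι := K) (B := √(m : ℝ) * D * ‖a‖)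
      (t := fun i x => inner ℝ (matrixRow i a) (x : EuclideanSpace ℝ (Fin n))) (fun i x => ?_)
      ⟨0, h0⟩ (fun i => by simp)
    exact (Finset.single_le_sum
      (f := fun i => |inner ℝ (matrixRow i a) (x : EuclideanSpace ℝ (Fin n))|)
      (fun i _ => abs_nonneg _) (Finset.mem_univ i)).trans (sum_abs_inner_matrixRow_le a (hK x x.2))
  have h1 : N * I ≤ (m : ℝ)⁻¹ * (2 * ∑ ε : Fin m → ℤˣ, ∫ a, signedSup K ε a ∂γ) := by
    have := Finset.sum_le_sum fun ε (_ : ε ∈ (Finset.univ : Finset (Fin m → ℤˣ))) =>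
      integral_l1Deviation_le_signedSup hm hD hK ε
    rw [← Finset.mul_sum, ← Finset.mul_sum] at this
    simpa [hN] using this
  have h2 : ∑ ε : Fin m → ℤˣ, ∫ a, signedSup K ε a ∂γ ≤
      2 * (N * (√(m : ℝ) * gaussianMeanWidth K)) := by
    rw [← integral_finsetSum _ fun ε _ => integrable_signedSup hD hK ε]
    refine (integral_mono (integrable_finsetSum _ fun ε _ => integrable_signedSup hD hK ε)
      ((integrable_finsetSum _ fun ε _ => hint ε).const_mul 2) hcontr).trans_eq ?_
    rw [integral_const_mul, integral_finsetSum _ fun ε _ => hint ε]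
    simp [integral_iSup_rowCombination hm hD hK, hN, γ]
  have h3 : N * I ≤ N * (4 * gaussianMeanWidth K / √(m : ℝ)) := by
    refine h1.trans ((mul_le_mul_of_nonneg_left (mul_le_mul_of_nonneg_left h2 zero_le_two)
      (by positivity)).trans_eq ?_)
    rw [div_eq_mul_inv, ← inv_natCast_mul_sqrt hm]
    ring
  exact le_of_mul_le_mul_left h3 hNpos

lemma gaussianMeanWidth_insert_zero_le (hD : 0 ≤ D) (hK : ∀ x ∈ K, ‖x‖ ≤ D) :
    gaussianMeanWidth (insert 0 K) ≤ gaussianMeanWidth K := by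
  have hK' : ∀ x ∈ insert 0 K, ‖x‖ ≤ D := by
    rintro x (rfl | hx)
    · simpa using hD
    · exact hK x hx
  refine integral_mono (integrable_iSup_abs_inner hD hK') (integrable_iSup_abs_inner hD hK)
    fun g => Real.iSup_le ?_ (Real.iSup_nonneg fun _ => abs_nonneg _)
  rintro ⟨x, rfl | hx⟩
  · simpa using Real.iSup_nonneg fun _ => abs_nonneg _
  · exact le_ciSup (bddAbove_abs_inner hK g) ⟨x, hx⟩

lemma l1Deviation_le_insert_zero (hm : 1 ≤ m) (hD : 0 ≤ D) (hK : ∀ x ∈ K, ‖x‖ ≤ D)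
    (a : EuclideanSpace ℝ (Fin m × Fin n)) :
    l1Deviation K (matrixOfVector a) ≤ l1Deviation (insert 0 K) (matrixOfVector a) := by
  have hK' : ∀ x ∈ insert 0 K, ‖x‖ ≤ D := by
    rintro x (rfl | hx)
    · simpa using hD
    · exact hK x hx
  rw [l1Deviation_matrixOfVector, l1Deviation_matrixOfVector]
  exact Real.iSup_le (fun x => le_ciSup (bddAbove_deviation hm hK' a)
    ⟨x, Set.mem_insert_of_mem _ x.2⟩) (Real.iSup_nonneg fun _ => abs_nonneg _)

theorem integral_l1Deviation_le (hm : 1 ≤ m) (hD : 0 ≤ D) (hK : ∀ x ∈ K, ‖x‖ ≤ D) :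
    ∫ a, l1Deviation K (matrixOfVector a) ∂(stdGaussian (EuclideanSpace ℝ (Fin m × Fin n))) ≤
      4 * gaussianMeanWidth K / √(m : ℝ) := by
  have hK' : ∀ x ∈ insert 0 K, ‖x‖ ≤ D := by
    rintro x (rfl | hx)
    · simpa using hD
    · exact hK x hx
  calc _ ≤ ∫ a, l1Deviation (insert 0 K) (matrixOfVector a)
          ∂(stdGaussian (EuclideanSpace ℝ (Fin m × Fin n))) :=
        integral_mono (integrable_l1Deviation hm hD hK) (integrable_l1Deviation hm hD hK')
          (l1Deviation_le_insert_zero hm hD hK)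
    _ ≤ 4 * gaussianMeanWidth (insert 0 K) / √(m : ℝ) :=
        integral_l1Deviation_le_of_zero_mem hm hD hK' (Set.mem_insert 0 K)
    _ ≤ _ := by
        have := gaussianMeanWidth_insert_zero_le hD hK
        gcongr

/-- The tail bound with any bound `D` for the radius of `K`; for `D = 0` the exponent is `0` by the
convention for division, and the bound is trivial. -/
theorem measureReal_l1Deviation_le (hm : 1 ≤ m) (hD : 0 ≤ D) (hK : ∀ x ∈ K, ‖x‖ ≤ D) {u : ℝ}
    (hu : 0 ≤ u) :
    (stdGaussian (EuclideanSpace ℝ (Fin m × Fin n))).real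
      {a | 4 * gaussianMeanWidth K / √(m : ℝ) + u < l1Deviation K (matrixOfVector a)} ≤
        Real.exp (-((m : ℝ) * u ^ 2 / (2 * D ^ 2))) := by
  have h := measureReal_add_le_of_abs_sub_le (by positivity) (abs_l1Deviation_sub_le hm hD hK) hu
  have h2 := integral_l1Deviation_le hm hD hK
  refine (measureReal_mono fun a ha => ?_).trans (h.trans_eq ?_)
  · have ha' : 4 * gaussianMeanWidth K / √(m : ℝ) + u < l1Deviation K (matrixOfVector a) := ha
    refine le_of_lt (lt_of_le_of_lt ?_ ha')
    linarith
  · rw [div_pow, Real.sq_sqrt (Nat.cast_nonneg m)]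
    have hm0 : (m : ℝ) ≠ 0 := by positivity
    congr 2
    rcases eq_or_ne D 0 with rfl | hD0
    · simp
    · field_simp

end Deviation

/-! ### From the canonical Gaussian vector to a Gaussian matrix -/

section Law

variable {Ω : Type*} [MeasurableSpace Ω] {μ : Measure Ω} {m n : ℕ}
  {A : Ω → Matrix (Fin m) (Fin n) ℝ} {K : Set (EuclideanSpace ℝ (Fin n))} {D : ℝ}

/-- The entries of a standard Gaussian matrix, listed as a vector, form a standard Gaussian
vector. -/
lemma IsStdGaussianMatrix.hasLaw [IsProbabilityMeasure μ] (hA : IsStdGaussianMatrix μ A) :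
    HasLaw (fun ω => (WithLp.toLp 2 fun p => A ω p.1 p.2 : EuclideanSpace ℝ (Fin m × Fin n)))
      (stdGaussian _) μ := by
  have h1 : ∀ p : Fin m × Fin n, AEMeasurable (fun ω => A ω p.1 p.2) μ := fun p =>
    (hA.hasLaw_entry p.1 p.2).aemeasurable
  have h2 := (iIndepFun_iff_map_fun_eq_pi_map h1).1 hA.indep_entries
  have h3 : AEMeasurable (fun ω (p : Fin m × Fin n) => A ω p.1 p.2) μ :=
    aemeasurable_pi_lambda _ h1
  have h4 : Measurable (WithLp.toLp 2 :
      (Fin m × Fin n → ℝ) → EuclideanSpace ℝ (Fin m × Fin n)) := by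
    fun_prop
  refine ⟨h4.comp_aemeasurable h3, ?_⟩
  rw [← map_pi_eq_stdGaussian]
  simp_rw [(hA.hasLaw_entry _ _).map_eq] at h2
  rw [← h2, AEMeasurable.map_map_of_aemeasurable h4.aemeasurable h3]
  rfl

lemma IsStdGaussianMatrix.integrable_l1Deviation [IsProbabilityMeasure μ]
    (hA : IsStdGaussianMatrix μ A) (hm : 1 ≤ m) (hD : 0 ≤ D) (hK : ∀ x ∈ K, ‖x‖ ≤ D) :
    Integrable (fun ω => l1Deviation K (A ω)) μ := by
  have h := _root_.integrable_l1Deviation hm hD hK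
  rw [← hA.hasLaw.map_eq] at h
  exact h.comp_aemeasurable hA.hasLaw.aemeasurable

lemma IsStdGaussianMatrix.integral_l1Deviation_le [IsProbabilityMeasure μ]
    (hA : IsStdGaussianMatrix μ A) (hm : 1 ≤ m) (hD : 0 ≤ D) (hK : ∀ x ∈ K, ‖x‖ ≤ D) :
    ∫ ω, l1Deviation K (A ω) ∂μ ≤ 4 * gaussianMeanWidth K / √(m : ℝ) := by
  refine le_of_eq_of_le ?_ (_root_.integral_l1Deviation_le hm hD hK)
  exact hA.hasLaw.integral_comp (_root_.integrable_l1Deviation hm hD hK).1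

lemma IsStdGaussianMatrix.measureReal_l1Deviation_le [IsProbabilityMeasure μ]
    (hA : IsStdGaussianMatrix μ A) (hm : 1 ≤ m) (hD : 0 ≤ D) (hK : ∀ x ∈ K, ‖x‖ ≤ D) {u : ℝ}
    (hu : 0 ≤ u) :
    μ.real {ω | 4 * gaussianMeanWidth K / √(m : ℝ) + u < l1Deviation K (A ω)} ≤
      2 * Real.exp (-((m : ℝ) * u ^ 2 / (2 * D ^ 2))) := by
  have hmeas : MeasurableSet {a : EuclideanSpace ℝ (Fin m × Fin n) |
      4 * gaussianMeanWidth K / √(m : ℝ) + u < l1Deviation K (matrixOfVector a)} :=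
    (isOpen_lt continuous_const
      (continuous_of_abs_sub_le (abs_l1Deviation_sub_le hm hD hK))).measurableSet
  have h := _root_.measureReal_l1Deviation_le hm hD hK hu
  rw [← hA.hasLaw.map_eq, Measure.real,
    Measure.map_apply_of_aemeasurable hA.hasLaw.aemeasurable hmeas] at h
  exact h.trans (by linarith [Real.exp_pos (-((m : ℝ) * u ^ 2 / (2 * D ^ 2)))])

end Law

/-! ### Almost isometric embeddings -/

section Embedding

open scoped Pointwise

variable {m n : ℕ} {K : Set (EuclideanSpace ℝ (Fin n))} {D : ℝ}

lemma norm_le_of_mem_sub (hK : ∀ x ∈ K, ‖x‖ ≤ D) : ∀ z ∈ K - K, ‖z‖ ≤ D + D := by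
  rintro _ ⟨x, hx, y, hy, rfl⟩
  exact (norm_sub_le x y).trans (add_le_add (hK x hx) (hK y hy))

lemma gaussianMeanWidth_sub_le (hD : 0 ≤ D) (hK : ∀ x ∈ K, ‖x‖ ≤ D) :
    gaussianMeanWidth (K - K) ≤ 2 * gaussianMeanWidth K := by
  rw [gaussianMeanWidth, gaussianMeanWidth, ← integral_const_mul]
  refine integral_mono (integrable_iSup_abs_inner (by positivity) (norm_le_of_mem_sub hK))
    ((integrable_iSup_abs_inner hD hK).const_mul 2) fun g => Real.iSup_le ?_
      (mul_nonneg zero_le_two (Real.iSup_nonneg fun _ => abs_nonneg _))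
  rintro ⟨_, x, hx, y, hy, rfl⟩
  have h1 := le_ciSup (bddAbove_abs_inner hK g) ⟨x, hx⟩
  have h2 := le_ciSup (bddAbove_abs_inner hK g) ⟨y, hy⟩
  simp only [inner_sub_right]
  refine (abs_sub _ _).trans ?_
  linarith

/-- A small deviation on the difference set controls all distances between points of `K`. -/
lemma isAlmostIsometricEmbedding_of_l1Deviation_le (hm : 1 ≤ m) (hK : ∀ x ∈ K, ‖x‖ ≤ D) {δ : ℝ}
    (hδ : 0 ≤ δ) (A : Matrix (Fin m) (Fin n) ℝ)
    (hA : l1Deviation (K - K) A ≤ δ * √(2 / Real.pi)) :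
    IsAlmostIsometricEmbedding δ
      (fun x : K => ((1 / (m : ℝ)) * √(Real.pi / 2)) • mulVecL1 A x) := by
  have hpi : √(Real.pi / 2) * √(2 / Real.pi) = 1 := by
    rw [← Real.sqrt_mul (by positivity)]
    have : Real.pi / 2 * (2 / Real.pi) = 1 := by field_simp
    rw [this, Real.sqrt_one]
  refine ⟨fun x x' => ?_, ?_⟩
  · have hb := bddAbove_deviation hm (norm_le_of_mem_sub hK)
      (WithLp.toLp 2 fun p : Fin m × Fin n => A p.1 p.2)
    simp only [← norm_mulVecL1_matrixOfVector] at hb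
    have h1 : |(m : ℝ)⁻¹ * ‖mulVecL1 A ((x : EuclideanSpace ℝ (Fin n)) - x')‖ -
        √(2 / Real.pi) * ‖(x : EuclideanSpace ℝ (Fin n)) - x'‖| ≤ δ * √(2 / Real.pi) :=
      (le_ciSup hb ⟨(x : EuclideanSpace ℝ (Fin n)) - x', Set.sub_mem_sub x.2 x'.2⟩).trans hA
    have h2 : dist (Set.rangeFactorization
          (fun x : K => ((1 / (m : ℝ)) * √(Real.pi / 2)) • mulVecL1 A x) x)
        (Set.rangeFactorization
          (fun x : K => ((1 / (m : ℝ)) * √(Real.pi / 2)) • mulVecL1 A x) x') - dist x x' =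
        √(Real.pi / 2) * ((m : ℝ)⁻¹ * ‖mulVecL1 A ((x : EuclideanSpace ℝ (Fin n)) - x')‖ -
          √(2 / Real.pi) * ‖(x : EuclideanSpace ℝ (Fin n)) - x'‖) := by
      rw [Subtype.dist_eq, Subtype.dist_eq, Set.rangeFactorization_coe,
        Set.rangeFactorization_coe, dist_eq_norm, dist_eq_norm, ← smul_sub, ← map_sub, norm_smul,
        Real.norm_of_nonneg (by positivity)]
      linear_combination ‖(x : EuclideanSpace ℝ (Fin n)) - x'‖ * hpi
    rw [h2, abs_mul, abs_of_nonneg (by positivity)]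
    refine (mul_le_mul_of_nonneg_left h1 (by positivity)).trans_eq ?_
    linear_combination δ * hpi
  · intro y
    obtain ⟨x, hx⟩ := Set.rangeFactorization_surjective y
    exact ⟨x, by rw [hx, dist_self]; exact hδ⟩

lemma gromovHausdorffEDist_le {X Y M : Type} [MetricSpace X] [MetricSpace Y] [hM : MetricSpace M]
    {Φ : X → M} {Ψ : Y → M} (hΦ : Isometry Φ) (hΨ : Isometry Ψ) :
    gromovHausdorffEDist X Y ≤ Metric.hausdorffEDist (Set.range Φ) (Set.range Ψ) :=
  sInf_le ⟨M, hM, Φ, Ψ, hΦ, hΨ, rfl⟩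

/-- A map with distortion `δ` moves `K` by at most `δ / 2` in Gromov-Hausdorff distance: glue `K` to
its image by placing every point at distance `δ / 2` from its image. -/
lemma gromovHausdorffEDist_image_le {δ : ℝ} (hδ : 0 < δ)
    (T : EuclideanSpace ℝ (Fin n) →ₗ[ℝ] PiLp 1 (fun _ : Fin m => ℝ))
    (hT : IsAlmostIsometricEmbedding δ (fun x : K => T x)) :
    gromovHausdorffEDist K (T '' K) ≤ ENNReal.ofReal δ := by
  rcases isEmpty_or_nonempty K with hK | hK
  · have hTK : IsEmpty (T '' K) := by
      rw [Set.isEmpty_coe_sort] at hK ⊢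
      simp [hK]
    refine (gromovHausdorffEDist_le (M := K) (Ψ := fun y => isEmptyElim y) isometry_id
      fun y => isEmptyElim y).trans ?_
    rw [Set.eq_empty_of_isEmpty (Set.range (id : K → K)),
      Set.eq_empty_of_isEmpty (Set.range _), Metric.hausdorffEDist_self]
    exact zero_le
  let Ψ : K → T '' K := fun x => ⟨T x, Set.mem_image_of_mem T x.2⟩
  have hε : 0 < δ / 2 := half_pos hδ
  have hH : ∀ p q : K, |dist (id p) (id q) - dist (Ψ p) (Ψ q)| ≤ 2 * (δ / 2) := fun p q => by
    rw [abs_sub_comm, mul_div_cancel₀ δ two_ne_zero]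
    exact hT.1 p q
  let M : MetricSpace (K ⊕ T '' K) := Metric.glueMetricApprox id Ψ (δ / 2) hε hH
  have hdist : ∀ x : K, edist (Sum.inl x : K ⊕ T '' K) (Sum.inr (Ψ x)) ≤ ENNReal.ofReal δ := by
    intro x
    rw [edist_dist]
    refine ENNReal.ofReal_le_ofReal ?_
    have : dist (Sum.inl x : K ⊕ T '' K) (Sum.inr (Ψ x)) = δ / 2 :=
      Metric.glueDist_glued_points id Ψ (δ / 2) x
    linarith
  refine (gromovHausdorffEDist_le (hM := M) (Φ := Sum.inl) (Ψ := Sum.inr)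
    (Isometry.of_dist_eq fun _ _ => rfl) (Isometry.of_dist_eq fun _ _ => rfl)).trans ?_
  refine Metric.hausdorffEDist_le_of_mem_edist ?_ ?_
  · rintro _ ⟨x, rfl⟩
    exact ⟨_, ⟨Ψ x, rfl⟩, hdist x⟩
  · rintro _ ⟨⟨_, x, hx, rfl⟩, rfl⟩
    refine ⟨_, ⟨⟨x, hx⟩, rfl⟩, ?_⟩
    rw [edist_comm]
    exact hdist ⟨x, hx⟩

/-- The choice of the absolute constant: `m ≥ 80² δ⁻² w(K)²` makes the expected deviation on the
difference set at most `δ / 10`. -/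
lemma four_mul_gaussianMeanWidth_sub_div_le (hm : 1 ≤ m) (hD : 0 ≤ D) (hK : ∀ x ∈ K, ‖x‖ ≤ D)
    {δ : ℝ} (hδ : 0 < δ) (h : 6400 * (δ ^ 2)⁻¹ * gaussianMeanWidth K ^ 2 ≤ (m : ℝ)) :
    4 * gaussianMeanWidth (K - K) / √(m : ℝ) ≤ δ / 10 := by
  have hs : 0 < √(m : ℝ) := Real.sqrt_pos.2 (by exact_mod_cast hm)
  have h1 : 80 * gaussianMeanWidth K / δ ≤ √(m : ℝ) := by
    refine Real.le_sqrt_of_sq_le (le_of_eq_of_le ?_ h)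
    field_simp
    ring
  rw [div_le_iff₀ hδ] at h1
  rw [div_le_iff₀ hs]
  linarith [gaussianMeanWidth_sub_le hD hK]

lemma three_fifths_le_sqrt_two_div_pi : 3 / 5 ≤ √(2 / Real.pi) := by
  refine Real.le_sqrt_of_sq_le ?_
  rw [le_div_iff₀ Real.pi_pos]
  linarith [Real.pi_le_four]

/-- The tail bound for the difference set `K - K`, of radius at most `2 r`, at level `δ / 2`; with
the mean at most `δ / 10`, the deviation stays below `δ √(2/π)` since `1/10 + 1/2 ≤ √(2/π)`. -/
theorem IsStdGaussianMatrix.le_measureReal_isAlmostIsometricEmbedding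
    {Ω : Type*} [MeasurableSpace Ω] {μ : Measure Ω} [IsProbabilityMeasure μ]
    {A : Ω → Matrix (Fin m) (Fin n) ℝ} (hA : IsStdGaussianMatrix μ A) (hm : 1 ≤ m)
    (hK : Bornology.IsBounded K) (hD : 0 ≤ D) (hKD : ∀ x ∈ K, ‖x‖ ≤ D) {δ : ℝ} (hδ : 0 < δ)
    (hCm : 6400 * (δ ^ 2)⁻¹ * gaussianMeanWidth K ^ 2 ≤ (m : ℝ)) {r : ℝ} (hr : 0 < r)
    (hdiam : Metric.diam K ≤ 2 * r) :
    1 - 2 * Real.exp (-((m : ℝ) * δ ^ 2 / (32 * r ^ 2))) ≤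
      μ.real {ω | IsAlmostIsometricEmbedding δ
        (fun x : K => ((1 / (m : ℝ)) * √(Real.pi / 2)) • mulVecL1 (A ω) x)} := by
  have hw := four_mul_gaussianMeanWidth_sub_div_le hm hD hKD hδ hCm
  have hdiff : ∀ z ∈ K - K, ‖z‖ ≤ 2 * r := by
    rintro _ ⟨x, hx, y, hy, rfl⟩
    rw [← dist_eq_norm]
    exact (Metric.dist_le_diam_of_mem hK hx hy).trans hdiam
  have htail := hA.measureReal_l1Deviation_le hm (by positivity) hdiff (half_pos hδ).le
  have hexp : (m : ℝ) * (δ / 2) ^ 2 / (2 * (2 * r) ^ 2) = (m : ℝ) * δ ^ 2 / (32 * r ^ 2) := by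
    field_simp
    ring
  rw [hexp] at htail
  set good := {ω | IsAlmostIsometricEmbedding δ
    (fun x : K => ((1 / (m : ℝ)) * √(Real.pi / 2)) • mulVecL1 (A ω) x)} with hgood
  have hsub : goodᶜ ⊆
      {ω | 4 * gaussianMeanWidth (K - K) / √(m : ℝ) + δ / 2 < l1Deviation (K - K) (A ω)} := by
    intro ω hω
    by_contra hcon
    refine hω (isAlmostIsometricEmbedding_of_l1Deviation_le hm hKD hδ.le (A ω)
      ((not_lt.1 hcon).trans ?_))
    have := mul_le_mul_of_nonneg_left three_fifths_le_sqrt_two_div_pi hδ.le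
    linarith
  -- subadditivity suffices, so the event `good` need not be measurable
  have hone : 1 ≤ μ.real good + μ.real goodᶜ := by
    have := measureReal_union_le (μ := μ) good goodᶜ
    rwa [Set.union_compl_self, probReal_univ] at this
  have := (measureReal_mono hsub (μ := μ)).trans htail
  linarith

theorem exists_isAlmostIsometricEmbedding (hm : 1 ≤ m) (hD : 0 ≤ D) (hKD : ∀ x ∈ K, ‖x‖ ≤ D)
    {δ : ℝ} (hδ : 0 < δ) (hCm : 6400 * (δ ^ 2)⁻¹ * gaussianMeanWidth K ^ 2 ≤ (m : ℝ)) :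
    ∃ T : EuclideanSpace ℝ (Fin n) →ₗ[ℝ] PiLp 1 (fun _ : Fin m => ℝ),
      IsAlmostIsometricEmbedding δ (fun x : K => T x) := by
  have hw := four_mul_gaussianMeanWidth_sub_div_le hm hD hKD hδ hCm
  have hD2 : 0 ≤ D + D := by positivity
  -- some realization of the matrix deviates at most as much as the mean
  obtain ⟨a, ha⟩ := exists_le_integral
    (integrable_l1Deviation (m := m) hm hD2 (norm_le_of_mem_sub hKD))
  have hemb := isAlmostIsometricEmbedding_of_l1Deviation_le hm hKD hδ.le (matrixOfVector a) (by
    have h1 := integral_l1Deviation_le (m := m) hm hD2 (norm_le_of_mem_sub hKD)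
    have h2 := mul_le_mul_of_nonneg_left three_fifths_le_sqrt_two_div_pi hδ.le
    linarith)
  exact ⟨((1 / (m : ℝ)) * √(Real.pi / 2)) • mulVecL1 (matrixOfVector a), hemb⟩

end Embedding

theorem mainTheorem6 :
    -- expectation and deviation inequality
    (∀ (n m : ℕ), 1 ≤ m →
      ∀ (K : Set (EuclideanSpace ℝ (Fin n))), Bornology.IsBounded K →
      ∀ (Ω : Type*) [MeasurableSpace Ω] (μ : Measure Ω) [IsProbabilityMeasure μ]
        (A : Ω → Matrix (Fin m) (Fin n) ℝ), IsStdGaussianMatrix μ A →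
      (Integrable (fun ω => l1Deviation K (A ω)) μ ∧
        ∫ ω, l1Deviation K (A ω) ∂μ ≤ 4 * gaussianMeanWidth K / √(m : ℝ)) ∧
      (∀ u : ℝ, 0 < u →
        μ.real {ω | 4 * gaussianMeanWidth K / √(m : ℝ) + u < l1Deviation K (A ω)}
          ≤ 2 * Real.exp (-((m : ℝ) * u ^ 2 / (2 * euclideanRadius K ^ 2))))) ∧
    -- almost isometric embedding into `ℓ₁ᵐ`, with an absolute constant `C`
    ∃ C : ℝ, 0 < C ∧
      ∀ (n m : ℕ), 1 ≤ m →
      ∀ (K : Set (EuclideanSpace ℝ (Fin n))), Bornology.IsBounded K →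
      ∀ δ : ℝ, 0 < δ → C * (δ ^ 2)⁻¹ * gaussianMeanWidth K ^ 2 ≤ (m : ℝ) →
      (∀ (Ω : Type*) [MeasurableSpace Ω] (μ : Measure Ω) [IsProbabilityMeasure μ]
        (A : Ω → Matrix (Fin m) (Fin n) ℝ), IsStdGaussianMatrix μ A →
        ∀ r : ℝ, 0 < r → Metric.diam K ≤ 2 * r →
        1 - 2 * Real.exp (-((m : ℝ) * δ ^ 2 / (32 * r ^ 2))) ≤
          μ.real {ω | IsAlmostIsometricEmbedding δ
            (fun x : K => ((1 / (m : ℝ)) * √(Real.pi / 2)) • mulVecL1 (A ω) x)}) ∧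
      (∃ T : EuclideanSpace ℝ (Fin n) →ₗ[ℝ] PiLp 1 (fun _ : Fin m => ℝ),
        IsAlmostIsometricEmbedding δ (fun x : K => T x) ∧
        gromovHausdorffEDist K (T '' K) ≤ ENNReal.ofReal δ) := by
  have hbound : ∀ {n : ℕ} {K : Set (EuclideanSpace ℝ (Fin n))}, Bornology.IsBounded K →
      (0 ≤ euclideanRadius K) ∧ ∀ x ∈ K, ‖x‖ ≤ euclideanRadius K := fun {n K} hK => by
    obtain ⟨R, hR⟩ := hK.exists_norm_le
    have hb : BddAbove (Set.range fun x : K => ‖(x : EuclideanSpace ℝ (Fin n))‖) :=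
      ⟨R, by rintro _ ⟨x, rfl⟩; exact hR x x.2⟩
    exact ⟨Real.iSup_nonneg fun _ => norm_nonneg _, fun x hx => le_ciSup hb ⟨x, hx⟩⟩
  refine ⟨fun n m hm K hK Ω _ μ _ A hA => ?_, 6400, by norm_num,
    fun n m hm K hK δ hδ hCm => ⟨fun Ω _ μ _ A hA r hr hdiam => ?_, ?_⟩⟩
  · obtain ⟨hD, hKD⟩ := hbound hK
    exact ⟨⟨hA.integrable_l1Deviation hm hD hKD, hA.integral_l1Deviation_le hm hD hKD⟩,
      fun u hu => hA.measureReal_l1Deviation_le hm hD hKD hu.le⟩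
  · obtain ⟨hD, hKD⟩ := hbound hK
    exact hA.le_measureReal_isAlmostIsometricEmbedding hm hK hD hKD hδ hCm hr hdiam
  · obtain ⟨hD, hKD⟩ := hbound hK
    obtain ⟨T, hT⟩ := exists_isAlmostIsometricEmbedding hm hD hKD hδ hCm
    exact ⟨T, hT, gromovHausdorffEDist_image_le hδ T hT⟩
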